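/- All vector spaces are over $\mathbb{C}$, and $\delta(x)=\sum_{n\in\mathbb{Z}}x^n$. In every formal expression a power of a sum or difference of two variables is expanded in nonnegative integral powers of the second variable. A *Möbius vertex algebra* is a $\mathbb{Z}$-graded vector space $V=\coprod_{n\in\mathbb{Z}}V_n$ with a linear map $Y:V\to \mathrm{End}(V)[[x,x^{-1}]]$, $v\mapsto Y(v,x)=\sum_{n\in\mathbb{Z}}v_nx^{-n-1}$, a vector $\mathbf 1\in V_0$, and a representation of $\mathfrak{sl}(2)$ on $V$ given by operators $L(-1),L(0),L(1)$ with $[L(0),L(-1)]=L(-1)$, $[L(0),L(1)]=-L(1)$, $[L(-1),L(1)]=-2L(0)$, such that for all $u,v\in V$ and $j\in\{-1,0,1\}$: - $u_nv=0$ for $n$ sufficiently large; $Y(\mathbf 1,x)=1_V$; $Y(v,x)\mathbf 1\in V[[x]]$ with constant term $v$; - (Jacobi identity) $x_0^{-1}\delta\left(\frac{x_1-x_2}{x_0}\right)Y(u,x_1)Y(v,x_2)-x_0^{-1}\delta\left(\frac{x_2-x_1}{-x_0}\right)Y(v,x_2)Y(u,x_1)=x_2^{-1}\delta\left(\frac{x_1-x_0}{x_2}\right)Y(Y(u,x_0)v,x_2)$;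 - $[L(j),Y(v,x)]=\sum_{k=0}^{j+1}\binom{j+1}{k}x^{j+1-k}Y(L(k-1)v,x)$ and $\frac{d}{dx}Y(v,x)=Y(L(-1)v,x)$; - $L(0)v=nv$ whenever $v\in V_n$. It is *$\mathbb{N}$-graded* if $V_n=0$ for all $n<0$. A *quasimodule* for $V$ is a vector space $W$ with a linear map $Y_W:V\to\mathrm{End}(W)[[x,x^{-1}]]$, $v\mapsto Y_W(v,x)=\sum_{n\in\mathbb{Z}}v_nx^{-n-1}$, and a representation of $\mathfrak{sl}(2)$ on $W$ given by operators $L_W(-1),L_W(0),L_W(1)$ satisfying the same three bracket relations, such that for all $u,v\in V$, $w\in W$ and $j\in\{-1,0,1\}$: $v_nw=0$ for $n$ sufficiently large; $Y_W(\mathbf 1,x)=1_W$; there is a nonzero polynomial $f(x_1,x_2)\in\mathbb{C}[x_1,x_2]$, depending on $u$ and $v$, with $$x_0^{-1}\delta\left(\tfrac{x_1-x_2}{x_0}\right)f(x_1,x_2)Y_W(u,x_1)Y_W(v,x_2)-x_0^{-1}\delta\left(\tfrac{x_2-x_1}{-x_0}\right)f(x_1,x_2)Y_W(v,x_2)Y_W(u,x_1)=x_2^{-1}\delta\left(\tfrac{x_1-x_0}{x_2}\right)f(x_1,x_2)Y_W(Y(u,x_0)v,x_2);$$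 $[L_W(j),Y_W(v,x)]=\sum_{k=0}^{j+1}\binom{j+1}{k}x^{j+1-k}Y_W(L(k-1)v,x)$; and $\frac{d}{dx}Y_W(v,x)=Y_W(L(-1)v,x)$. $W$ is *generated* by $S\subseteq W$ if $W$ is the smallest subspace of $W$ that contains $S$ and is stable under all modes $v_n$ ($v\in V$, $n\in\mathbb{Z}$); it is *finitely generated* if it is generated by some finite $S$. For $n\ge 2$ let $C_n(W)=\mathrm{span}\{v_{-n}w: v\in V,\ w\in W\}$; $W$ is *$C_n$-cofinite* if $W/C_n(W)$ is finite-dimensional. Likewise $V$ is *$C_n$-cofinite* if $V/C_n(V)$ is finite-dimensional, where $C_n(V)=\mathrm{span}\{u_{-n}v:u,v\in V\}$. Let $c_1(W)=\mathrm{span}\{v_{-1}w: v\in\coprod_{n>0}V_n,\ w\in W\}$; $W$ is *$c_1$-cofinite* if $W/c_1(W)$ is finite-dimensional. **Theorem.** Let $V$ be a $C_2$-cofinite $\mathbb{N}$-graded Möbius vertex algebra, and let $W$ be a quasimodule for $V$. If $W$ is generated by a single vector, then $W$ is $C_n$-cofinite for every $n\ge 2$ and $W$ is $c_1$-cofinite.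 The same conclusion holds whenever $W$ is finitely generated. -/

import Mathlib

noncomputable section

/-- A linear map `v ↦ Y(v,x) = ∑ₙ vₙ x^(-n-1)` from `V` to `End(W)[[x,x⁻¹]]`, recorded through its
modes: `Y v n` is the endomorphism `vₙ` of `W`. -/
abbrev VertexMap (V W : Type*) [AddCommGroup V] [Module ℂ V] [AddCommGroup W] [Module ℂ W] :=
  V →ₗ[ℂ] (ℤ → Module.End ℂ W)

/-- Formal distributions in `x₀, x₁, x₂` with coefficients in `W`: `D l m n` is the coefficient of
`x₀^(-l-1) x₁^(-m-1) x₂^(-n-1)`. -/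
abbrev FormalDistribution (W : Type*) := ℤ → ℤ → ℤ → W

section FormalCalculus

variable {V W : Type*} [AddCommGroup V] [Module ℂ V] [AddCommGroup W] [Module ℂ W]

/-- Multiplication of a formal distribution by a polynomial `f(x₁,x₂)`; multiplying by `x₁^i x₂^j`
shifts the index `m` by `i` and the index `n` by `j`. -/
def polyMul (f : MvPolynomial (Fin 2) ℂ) (D : FormalDistribution W) : FormalDistribution W :=
  fun l m n => ∑ d ∈ f.support, f.coeff d • D l (m + d 0) (n + d 1)

/-- Lower truncation: for all `v`, `w` one has `vₙ w = 0` for `n` sufficiently large. -/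
def VertexMap.LowerTruncated (Y : VertexMap V W) : Prop :=
  ∀ (v : V) (w : W), ∃ N : ℤ, ∀ n : ℤ, N ≤ n → Y v n w = 0

/-- The distribution `x₀⁻¹ δ((x₁ - x₂)/x₀) Y(u,x₁) Y(v,x₂) w`. Here `(x₁ - x₂)^l` is expanded in
nonnegative powers of `x₂`; the sums are finite by lower truncation. -/
def jacobiFst (Y : VertexMap V W) (u v : V) (w : W) : FormalDistribution W :=
  fun l m n => ∑ᶠ k : ℕ,
    ((-1 : ℂ) ^ k * ((Ring.choose l k : ℤ) : ℂ)) • Y u (m + l - k) (Y v (n + k) w)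

/-- The distribution `x₀⁻¹ δ((x₂ - x₁)/(-x₀)) Y(v,x₂) Y(u,x₁) w`. Here `(x₂ - x₁)^l` is expanded in
nonnegative powers of `x₁`; the sums are finite by lower truncation. -/
def jacobiSnd (Y : VertexMap V W) (u v : V) (w : W) : FormalDistribution W :=
  fun l m n => ∑ᶠ k : ℕ,
    ((-1 : ℂ) ^ (l + k) * ((Ring.choose l k : ℤ) : ℂ)) • Y v (n + l - k) (Y u (m + k) w)

/-- The distribution `x₂⁻¹ δ((x₁ - x₀)/x₂) Y_W(Y(u,x₀)v,x₂) w`. Here powers of `x₁ - x₀` are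
expanded in nonnegative powers of `x₀`, and the coefficient `(-1)^k * choose (k-m-1) k` of the
expansion is written as `choose m k`; the sums are finite by lower truncation of `Y`. -/
def jacobiIter (Y : VertexMap V V) (YW : VertexMap V W) (u v : V) (w : W) :
    FormalDistribution W :=
  fun l m n => ∑ᶠ k : ℕ,
    ((Ring.choose m k : ℤ) : ℂ) • YW (Y u (l + k) v) (m + n - k) w

/-- Three operators `L 0 = L(-1)`, `L 1 = L(0)`, `L 2 = L(1)` (so `L i` stands for `L(i-1)`) that
satisfy the bracket relations of the basis `L₋₁, L₀, L₁` of `sl(2)`, i.e. a representation of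
`sl(2)` on `W`. -/
structure IsSl2Action (L : Fin 3 → Module.End ℂ W) : Prop where
  zero_neg : ⁅L 1, L 0⁆ = L 0
  zero_pos : ⁅L 1, L 2⁆ = -L 2
  neg_pos : ⁅L 0, L 2⁆ = -((2 : ℂ) • L 1)

/-- The two compatibility conditions between a vertex map and the `sl(2)`-actions `L` on `V` and
`LW` on `W`, in modes (the index `i` stands for `j + 1`):
`[L_W(j), Y(v,x)] = ∑_{k=0}^{j+1} choose (j+1) k x^(j+1-k) Y(L(k-1)v, x)` for `j = -1, 0, 1`, and
`d/dx Y(v,x) = Y(L(-1)v,x)`. -/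
structure IsSl2Covariant (L : Fin 3 → Module.End ℂ V) (LW : Fin 3 → Module.End ℂ W)
    (Y : VertexMap V W) : Prop where
  comm : ∀ (i : Fin 3) (v : V) (n : ℤ),
    ⁅LW i, Y v n⁆ =
      ∑ k : Fin 3, (Nat.choose (i : ℕ) (k : ℕ) : ℂ) • Y (L k v) (n + (i : ℕ) - (k : ℕ))
  deriv : ∀ (v : V) (n : ℤ), Y (L 0 v) n = (-n : ℂ) • Y v (n - 1)

/-- `C_n(W)`, the span of all `v_{-n} w` with `v ∈ V` and `w ∈ W`. -/
def VertexMap.C (Y : VertexMap V W) (n : ℕ) : Submodule ℂ W :=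
  Submodule.span ℂ {x | ∃ (v : V) (w : W), x = Y v (-(n : ℤ)) w}

end FormalCalculus

/-- A Möbius vertex algebra structure on the complex vector space `V`. -/
structure MobiusVertexAlgebra (V : Type*) [AddCommGroup V] [Module ℂ V] where
  /-- The homogeneous subspace of each weight. -/
  wt : ℤ → Submodule ℂ V
  isInternal : DirectSum.IsInternal wt
  Y : VertexMap V V
  /-- The vacuum vector. -/
  vac : V
  vac_mem : vac ∈ wt 0
  /-- The representation of `sl(2)`: `L i` is `L(i-1)`. -/
  L : Fin 3 → Module.End ℂ V
  truncation : Y.LowerTruncated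
  vacuum : ∀ n : ℤ, Y vac n = if n = -1 then 1 else 0
  creation_nonneg : ∀ (v : V) (n : ℤ), 0 ≤ n → Y v n vac = 0
  creation : ∀ v : V, Y v (-1) vac = v
  jacobi : ∀ u v w : V, jacobiFst Y u v w - jacobiSnd Y u v w = jacobiIter Y Y u v w
  sl2 : IsSl2Action L
  covariant : IsSl2Covariant L L Y
  weight : ∀ (n : ℤ) (v : V), v ∈ wt n → L 1 v = (n : ℂ) • v

namespace MobiusVertexAlgebra

variable {V : Type*} [AddCommGroup V] [Module ℂ V] (A : MobiusVertexAlgebra V)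

/-- `V` is `ℕ`-graded: `V_n = 0` for `n < 0`. -/
def IsNGraded : Prop := ∀ n : ℤ, n < 0 → A.wt n = ⊥

/-- `V` is `C_n`-cofinite: `V / C_n(V)` is finite-dimensional. -/
def IsCofinite (n : ℕ) : Prop := FiniteDimensional ℂ (V ⧸ A.Y.C n)

/-- The sum of the homogeneous subspaces of positive weight. -/
def positivePart : Submodule ℂ V := ⨆ n : ℤ, ⨆ _ : 0 < n, A.wt n

end MobiusVertexAlgebra

/-- A quasimodule structure on the complex vector space `W` for a Möbius vertex algebra. -/
structure Quasimodule {V : Type*} [AddCommGroup V] [Module ℂ V] (A : MobiusVertexAlgebra V)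
    (W : Type*) [AddCommGroup W] [Module ℂ W] where
  Y : VertexMap V W
  /-- The representation of `sl(2)`: `L i` is `L_W(i-1)`. -/
  L : Fin 3 → Module.End ℂ W
  truncation : Y.LowerTruncated
  vacuum : ∀ n : ℤ, Y A.vac n = if n = -1 then 1 else 0
  quasiJacobi : ∀ u v : V, ∃ f : MvPolynomial (Fin 2) ℂ, f ≠ 0 ∧ ∀ w : W,
    polyMul f (jacobiFst Y u v w) - polyMul f (jacobiSnd Y u v w) =
      polyMul f (jacobiIter A.Y Y u v w)
  sl2 : IsSl2Action L
  covariant : IsSl2Covariant A.L L Y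

namespace Quasimodule

variable {V : Type*} [AddCommGroup V] [Module ℂ V] {A : MobiusVertexAlgebra V}
  {W : Type*} [AddCommGroup W] [Module ℂ W] (M : Quasimodule A W)

/-- `W` is generated by `S`: the only subspace that contains `S` and is stable under all modes
`vₙ` is `W` itself. -/
def IsGeneratedBy (S : Set W) : Prop :=
  ∀ N : Submodule ℂ W, S ⊆ N → (∀ (v : V) (n : ℤ), ∀ x ∈ N, M.Y v n x ∈ N) → N = ⊤

/-- `W` is `C_n`-cofinite: `W / C_n(W)` is finite-dimensional. -/
def IsCofinite (n : ℕ) : Prop := FiniteDimensional ℂ (W ⧸ M.Y.C n)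

/-- `c_1(W)`, the span of all `v_{-1} w` with `v` of positive weight and `w ∈ W`. Without the
restriction on `v` this would be all of `W`, by the vacuum property. -/
def c1 : Submodule ℂ W :=
  Submodule.span ℂ {x | ∃ v ∈ A.positivePart, ∃ w : W, x = M.Y v (-1) w}

/-- `W` is `c_1`-cofinite: `W / c_1(W)` is finite-dimensional. -/
def IsC1Cofinite : Prop := FiniteDimensional ℂ (W ⧸ M.c1)

end Quasimodule

end

/-!
Two facts are behind the theorem.

*A quasimodule is a module.* The three terms of the Jacobi identity for `u, v` differ by a
distribution `D(x₀,x₁,x₂)` on which `x₀` acts as `x₁ - x₂`. If `f(x₁,x₂) D = 0`, then substituting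
`x₁ = x₀ + x₂` gives a nonzero `g(x₀,x₂)` with `g D = 0`. Bracketing with `L(-1)` replaces `g` by
`∂g/∂x₂`, and for homogeneous `u, v` bracketing with `L(0)` replaces it by its Euler derivative. This
separates the monomials of `g`, so that a single monomial kills `D`; as multiplication by a monomial
only shifts indices, `D = 0`. See
`eq_zero_of_polyMul_eq_zero` and `Quasimodule.jacobi`. The three terms are treated uniformly, since
each of them is a binomial convolution `binomConv`.

*The associated graded space is finite-dimensional.* Let a finite set `S` generate `W`. Filter `W` by
the subspaces `G p` spanned by the vectors obtained from `S` by applying modes of homogeneous vectors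
of total weight at most `p`; they vanish for `p < 0`. On the associated graded space modes commute,
because `u_k v` with `k ≥ 0` has smaller weight than `u` and `v` together; `C₂(V)` acts by zero,
because `u_{-2} v` has larger weight; and the field of `u_{-1} v` is the product of the fields of
`u` and `v`. Commutativity shows that each field has only finitely many nonzero modes `v_m` with
`m ≥ 0`, as this holds on `S`. After dividing by the images of all `v_i` with `i ≤ -n` the fields are
Laurent polynomials over a commutative algebra `R` of operators. They form a quotient of `V / C₂(V)`,
that is, a finite-dimensional algebra, so they are integral over `ℂ`, and hence so are their
coefficients, as a polynomial is integral over `ℂ[x]` only if its coefficients are integral over `ℂ`.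
Therefore `R` is finite-dimensional, and so is the quotient, which `R` generates from `S`
(`finiteDimensional_of_commuting_fields`, `Quasimodule.finiteDimensional_reducedGraded`).
Lifting it to `W` gives, by induction on `p`, a finite-dimensional `F` with `W = F + C_n(W)`.

Finally `C₂(W) ⊆ c₁(W)`, because `v_{-2} = (L(-1)v)_{-1}` and `L(-1)` raises the weight.
-/

noncomputable section

/-! ### Binomial convolutions -/

section BinomialConvolution

variable {W : Type*} [AddCommGroup W] [Module ℂ W]

/-- For a doubly indexed family `a`, with generating series `a(x₁,x₂) = ∑ a i j x₁^(-i-1) x₂^(-j-1)`,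
this is the coefficient of `x₁^(-m-1) x₂^(-n-1)` in `(x₁ - x₂)^l a(x₁,x₂)`, the power being expanded
in nonnegative powers of `x₂`. The sum is finite when `a i j = 0` for all large `j`. -/
def binomConv (a : ℤ → ℤ → W) (l m n : ℤ) : W :=
  ∑ᶠ k : ℕ, ((-1 : ℂ) ^ k * ((Ring.choose l k : ℤ) : ℂ)) • a (m + l - k) (n + k)

/-- The family `a` vanishes for large values of its second index, uniformly in the first. -/
def IsTruncated (a : ℤ → ℤ → W) : Prop := ∃ N : ℤ, ∀ j, N ≤ j → ∀ i, a i j = 0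

lemma binomConv_eq_sum {a : ℤ → ℤ → W} {N : ℤ} (ha : ∀ j, N ≤ j → ∀ i, a i j = 0)
    (l m n : ℤ) (K : ℕ) (hK : N ≤ n + K) :
    binomConv a l m n = ∑ k ∈ Finset.range K,
      ((-1 : ℂ) ^ k * ((Ring.choose l k : ℤ) : ℂ)) • a (m + l - k) (n + k) := by
  refine finsum_eq_sum_of_support_subset _ fun k hk => ?_
  by_contra h
  simp only [Finset.coe_range, Set.mem_Iio, not_lt] at h
  exact hk (by simp only [ha (n + k) (by omega), smul_zero])

lemma exists_le_add_natCast (N n : ℤ) : ∃ K : ℕ, N ≤ n + K := ⟨(N - n).toNat, by omega⟩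

/-- `(x₁ - x₂)^(l+1) = (x₁ - x₂)^l x₁ - (x₁ - x₂)^l x₂`. -/
lemma binomConv_succ {a : ℤ → ℤ → W} (ha : IsTruncated a) (l m n : ℤ) :
    binomConv a (l + 1) m n = binomConv a l (m + 1) n - binomConv a l m (n + 1) := by
  obtain ⟨N, hN⟩ := ha
  obtain ⟨K, hK⟩ := exists_le_add_natCast N n
  rw [binomConv_eq_sum hN _ _ _ (K + 1) (by push_cast; omega),
    binomConv_eq_sum hN _ _ _ (K + 1) (by push_cast; omega),
    binomConv_eq_sum hN _ _ _ K (by omega), Finset.sum_range_succ', Finset.sum_range_succ',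
    add_sub_right_comm (α := W), ← Finset.sum_sub_distrib]
  congr 1
  · refine Finset.sum_congr rfl fun k _ => ?_
    rw [Ring.choose_succ_succ, show m + (l + 1) - ((k + 1 : ℕ) : ℤ) = m + l - k by push_cast; ring,
      show m + 1 + l - ((k + 1 : ℕ) : ℤ) = m + l - k by push_cast; ring,
      show n + ((k + 1 : ℕ) : ℤ) = n + 1 + k by push_cast; ring, ← sub_smul]
    congr 1
    push_cast
    ring
  · simp [add_comm, add_left_comm]

lemma succ_mul_choose_succ (l : ℤ) (k : ℕ) :
    ((k : ℤ) + 1) * Ring.choose l (k + 1) = l * Ring.choose (l - 1) k := by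
  have h := Ring.choose_smul_choose l (n := k + 1) (k := 1) (by omega)
  simpa using h

lemma sub_mul_choose (l : ℤ) (k : ℕ) :
    (l - k) * Ring.choose l k = l * Ring.choose (l - 1) k := by
  have h := succ_mul_choose_succ (l + 1) k
  have h2 := succ_mul_choose_succ l k
  rw [Ring.choose_succ_succ, show l + 1 - 1 = l by ring] at h
  linear_combination h2 - h

variable {W' : Type*} [AddCommGroup W'] [Module ℂ W']

lemma binomConv_map {a : ℤ → ℤ → W} (ha : IsTruncated a) (T : W →ₗ[ℂ] W') (l m n : ℤ) :
    T (binomConv a l m n) = binomConv (fun i j => T (a i j)) l m n := by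
  obtain ⟨N, hN⟩ := ha
  obtain ⟨K, hK⟩ := exists_le_add_natCast N n
  rw [binomConv_eq_sum hN _ _ _ K hK,
    binomConv_eq_sum (a := fun i j => T (a i j)) (N := N) (fun j hj i => by simp [hN j hj i])
    _ _ _ K hK]
  simp

lemma binomConv_add {a b : ℤ → ℤ → W} (ha : IsTruncated a) (hb : IsTruncated b) (l m n : ℤ) :
    binomConv (fun i j => a i j + b i j) l m n = binomConv a l m n + binomConv b l m n := by
  obtain ⟨N, hN⟩ := ha
  obtain ⟨N', hN'⟩ := hb
  obtain ⟨K, hK⟩ := exists_le_add_natCast (max N N') n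
  have := le_max_left N N'
  have := le_max_right N N'
  rw [binomConv_eq_sum hN _ _ _ K (by omega), binomConv_eq_sum hN' _ _ _ K (by omega),
    binomConv_eq_sum (a := fun i j => a i j + b i j) (N := max N N')
      (fun j hj i => by simp [hN j (by omega) i, hN' j (by omega) i])  _ _ _ K (by omega),
    ← Finset.sum_add_distrib]
  simp only [smul_add]

/-- The product rule for `∂/∂x₁` and `(x₁ - x₂)^l`: the generating series of `i • a (i-1) j` is
`-∂/∂x₁` of that of `a`. -/
lemma binomConv_deriv_fst {a : ℤ → ℤ → W} (ha : IsTruncated a) (l m n : ℤ) :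
    binomConv (fun i j => (i : ℂ) • a (i - 1) j) l m n =
      (m : ℂ) • binomConv a l (m - 1) n + (l : ℂ) • binomConv a (l - 1) m n := by
  obtain ⟨N, hN⟩ := ha
  obtain ⟨K, hK⟩ := exists_le_add_natCast N n
  rw [binomConv_eq_sum (a := fun i j => (i : ℂ) • a (i - 1) j) (N := N)
      (fun j hj i => by simp [hN j hj]) _ _ _ K hK,
    binomConv_eq_sum hN _ _ _ K hK, binomConv_eq_sum hN _ _ _ K hK, Finset.smul_sum,
    Finset.smul_sum, ← Finset.sum_add_distrib]
  refine Finset.sum_congr rfl fun k _ => ?_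
  rw [show m + l - (k : ℤ) - 1 = m - 1 + l - k by ring,
    show m + (l - 1) - (k : ℤ) = m - 1 + l - k by ring, smul_smul, smul_smul, smul_smul, ← add_smul]
  congr 1
  have h := congrArg (Int.cast : ℤ → ℂ) (sub_mul_choose l k)
  push_cast at h ⊢
  linear_combination (-1) ^ k * h

/-- The product rule for `∂/∂x₂` and `(x₁ - x₂)^l`: the generating series of `j • a i (j-1)` is
`-∂/∂x₂` of that of `a`. -/
lemma binomConv_deriv_snd {a : ℤ → ℤ → W} (ha : IsTruncated a) (l m n : ℤ) :
    binomConv (fun i j => (j : ℂ) • a i (j - 1)) l m n =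
      (n : ℂ) • binomConv a l m (n - 1) - (l : ℂ) • binomConv a (l - 1) m n := by
  obtain ⟨N, hN⟩ := ha
  obtain ⟨K, hK⟩ := exists_le_add_natCast N n
  rw [binomConv_eq_sum (a := fun i j => (j : ℂ) • a i (j - 1)) (N := N + 1)
      (fun j hj i => by simp [hN (j - 1) (by omega)]) _ _ _ (K + 1) (by push_cast; omega),
    binomConv_eq_sum hN _ _ _ (K + 1) (by push_cast; omega), binomConv_eq_sum hN _ _ _ K hK,
    Finset.smul_sum, Finset.smul_sum, Finset.sum_range_succ', Finset.sum_range_succ',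
    add_sub_right_comm (α := W), ← Finset.sum_sub_distrib]
  congr 1
  · refine Finset.sum_congr rfl fun k _ => ?_
    rw [show m + l - ((k + 1 : ℕ) : ℤ) = m + (l - 1) - k by push_cast; ring,
      show n + ((k + 1 : ℕ) : ℤ) - 1 = n + k by push_cast; ring,
      show n - 1 + ((k + 1 : ℕ) : ℤ) = n + k by push_cast; ring, smul_smul, smul_smul, smul_smul,
      ← sub_smul]
    congr 1
    have h := congrArg (Int.cast : ℤ → ℂ) (succ_mul_choose_succ l k)
    push_cast at h ⊢
    linear_combination (-1) ^ (k + 1) * h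
  · simp

end BinomialConvolution

/-! ### The Jacobi defect of a quasimodule -/

section Annihilation

variable {W : Type*} [AddCommGroup W] [Module ℂ W]

/-- The action of a polynomial `g(x₀,x₂)` on formal distributions in `x₀, x₁, x₂`. -/
def polyMul₀₂ (g : MvPolynomial (Fin 2) ℂ) (D : FormalDistribution W) : FormalDistribution W :=
  fun l m n => (AddMonoidAlgebra.coeff g).sum fun d c => c • D (l + d 0) m (n + d 1)

lemma polyMul_eq_sum (f : MvPolynomial (Fin 2) ℂ) (D : FormalDistribution W) (l m n : ℤ) :
    polyMul f D l m n = (AddMonoidAlgebra.coeff f).sum fun d c => c • D l (m + d 0) (n + d 1) := rfl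

lemma polyMul_add (f g : MvPolynomial (Fin 2) ℂ) (D : FormalDistribution W) (l m n : ℤ) :
    polyMul (f + g) D l m n = polyMul f D l m n + polyMul g D l m n := by
  simp only [polyMul_eq_sum, AddMonoidAlgebra.coeff_add]
  exact Finsupp.sum_add_index' (by simp) (by simp [add_smul])

lemma polyMul₀₂_add (f g : MvPolynomial (Fin 2) ℂ) (D : FormalDistribution W) (l m n : ℤ) :
    polyMul₀₂ (f + g) D l m n = polyMul₀₂ f D l m n + polyMul₀₂ g D l m n := by
  simp only [polyMul₀₂, AddMonoidAlgebra.coeff_add]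
  exact Finsupp.sum_add_index' (by simp) (by simp [add_smul])

lemma polyMul_monomial (d : Fin 2 →₀ ℕ) (c : ℂ) (D : FormalDistribution W) (l m n : ℤ) :
    polyMul (MvPolynomial.monomial d c) D l m n = c • D l (m + d 0) (n + d 1) := by
  rw [polyMul_eq_sum]
  exact MvPolynomial.sum_monomial_eq (by simp)

lemma polyMul₀₂_monomial (d : Fin 2 →₀ ℕ) (c : ℂ) (D : FormalDistribution W) (l m n : ℤ) :
    polyMul₀₂ (MvPolynomial.monomial d c) D l m n = c • D (l + d 0) m (n + d 1) := by
  rw [polyMul₀₂]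
  exact MvPolynomial.sum_monomial_eq (by simp)

lemma polyMul_mul_X (f : MvPolynomial (Fin 2) ℂ) (D : FormalDistribution W) (l m n : ℤ) :
    polyMul (f * MvPolynomial.X 0) D l m n = polyMul f D l (m + 1) n ∧
      polyMul (f * MvPolynomial.X 1) D l m n = polyMul f D l m (n + 1) := by
  induction f using MvPolynomial.induction_on' with
  | monomial d c =>
    constructor <;>
    · rw [MvPolynomial.X, MvPolynomial.monomial_mul, polyMul_monomial, polyMul_monomial]
      simp [add_assoc, add_comm]
  | add p q hp hq => simp only [add_mul, polyMul_add, hp, hq, and_self]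

lemma polyMul₀₂_mul_X (f : MvPolynomial (Fin 2) ℂ) (D : FormalDistribution W) (l m n : ℤ) :
    polyMul₀₂ (f * MvPolynomial.X 0) D l m n = polyMul₀₂ f D (l + 1) m n ∧
      polyMul₀₂ (f * MvPolynomial.X 1) D l m n = polyMul₀₂ f D l m (n + 1) := by
  induction f using MvPolynomial.induction_on' with
  | monomial d c =>
    constructor <;>
    · rw [MvPolynomial.X, MvPolynomial.monomial_mul, polyMul₀₂_monomial, polyMul₀₂_monomial]
      simp [add_assoc, add_comm]
  | add p q hp hq => simp only [add_mul, polyMul₀₂_add, hp, hq, and_self]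

/-- The substitution `x₁ = x₀ + x₂`. -/
def substSum : MvPolynomial (Fin 2) ℂ →ₐ[ℂ] MvPolynomial (Fin 2) ℂ :=
  MvPolynomial.aeval ![MvPolynomial.X 0 + MvPolynomial.X 1, MvPolynomial.X 1]

lemma substSum_ne_zero {f : MvPolynomial (Fin 2) ℂ} (hf : f ≠ 0) : substSum f ≠ 0 := by
  intro h
  let s : MvPolynomial (Fin 2) ℂ →ₐ[ℂ] MvPolynomial (Fin 2) ℂ :=
    MvPolynomial.aeval ![MvPolynomial.X 0 - MvPolynomial.X 1, MvPolynomial.X 1]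
  have hs : s.comp substSum = AlgHom.id ℂ _ := by
    ext i : 1
    fin_cases i <;> simp [s, substSum]
  apply hf
  rw [← AlgHom.id_apply (R := ℂ) f, ← hs, AlgHom.comp_apply, h, map_zero]

/-- On distributions on which `x₀` acts as `x₁ - x₂`, a polynomial in `x₁, x₂` acts through the
substitution `x₁ = x₀ + x₂`. -/
lemma polyMul_eq_polyMul₀₂ {D : FormalDistribution W}
    (hD : ∀ l m n, D (l + 1) m n = D l (m + 1) n - D l m (n + 1))
    (f : MvPolynomial (Fin 2) ℂ) (l m n : ℤ) :
    polyMul f D l m n = polyMul₀₂ (substSum f) D l m n := by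
  have key : ∀ (g : MvPolynomial (Fin 2) ℂ) (l m n : ℤ),
      polyMul₀₂ g D (l + 1) m n + polyMul₀₂ g D l m (n + 1) = polyMul₀₂ g D l (m + 1) n := by
    intro g l m n
    induction g using MvPolynomial.induction_on' with
    | monomial d c =>
      rw [polyMul₀₂_monomial, polyMul₀₂_monomial, polyMul₀₂_monomial, ← smul_add,
        add_right_comm l, hD, add_right_comm n, sub_add_cancel]
    | add p q hp hq => rw [polyMul₀₂_add, polyMul₀₂_add, polyMul₀₂_add, ← hp, ← hq]; abel
  induction f using MvPolynomial.induction_on generalizing l m n with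
  | C c =>
    rw [← MvPolynomial.algebraMap_eq, AlgHom.commutes, MvPolynomial.algebraMap_eq,
      MvPolynomial.C_apply, polyMul_monomial, polyMul₀₂_monomial]
    simp
  | add p q hp hq => rw [map_add, polyMul_add, polyMul₀₂_add, hp, hq]
  | mul_X p i hp =>
    fin_cases i
    · simp only [Fin.zero_eta, (polyMul_mul_X p D l m n).1, map_mul, hp]
      rw [← key, ← (polyMul₀₂_mul_X _ D l m n).1, ← (polyMul₀₂_mul_X _ D l m n).2,
        ← polyMul₀₂_add, ← mul_add]
      simp [substSum]
    · simp only [Fin.mk_one, (polyMul_mul_X p D l m n).2, map_mul, hp]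
      rw [← (polyMul₀₂_mul_X _ D l m n).2]
      simp [substSum]

/-- A space of finitely supported functions that contains a nonzero one and is stable under
multiplication by functions that separate points contains a function supported at a point. -/
lemma exists_single_mem {ι κ : Type*} (φ : κ → ι → ℂ) (hφ : ∀ d e, (∀ k, φ k d = φ k e) → d = e)
    (N : Submodule ℂ (ι →₀ ℂ))
    (hN : ∀ g ∈ N, ∀ k, ∀ g' : ι →₀ ℂ, (∀ d, g' d = φ k d * g d) → g' ∈ N)
    (g : ι →₀ ℂ) (hg : g ∈ N) (hg0 : g ≠ 0) : ∃ d, Finsupp.single d 1 ∈ N := by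
  classical
  induction h : g.support.card using Nat.strong_induction_on generalizing g with
  | _ s ih =>
  obtain ⟨d, hd⟩ := Finsupp.support_nonempty_iff.2 hg0
  by_cases hs : ∃ e ∈ g.support, e ≠ d
  · obtain ⟨e, he, hed⟩ := hs
    obtain ⟨k, hk⟩ : ∃ k, φ k e ≠ φ k d := by
      by_contra! hc
      exact hed (hφ _ _ hc)
    -- multiplying by `φ k - φ k d` removes `d` from the support and keeps `e`
    let g₁ : ι →₀ ℂ := Finsupp.onFinset g.support (fun x => φ k x * g x) (fun x hx => by
      simp only [Finsupp.mem_support_iff]; exact right_ne_zero_of_mul hx)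
    have hg₁ : ∀ x, g₁ x = φ k x * g x := fun x => rfl
    have hmem : g₁ - φ k d • g ∈ N := N.sub_mem (hN g hg k g₁ hg₁) (N.smul_mem _ hg)
    have happ : ∀ x, (g₁ - φ k d • g) x = (φ k x - φ k d) * g x := fun x => by
      simp [hg₁, sub_mul]
    refine ih _ ?_ _ hmem ?_ rfl
    · rw [← h]
      refine Finset.card_lt_card ⟨fun x hx => ?_, fun hsub => ?_⟩
      · rw [Finsupp.mem_support_iff, happ] at hx
        exact Finsupp.mem_support_iff.2 (right_ne_zero_of_mul hx)
      · have := hsub hd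
        simp [happ] at this
    · intro h0
      have := happ e
      rw [h0] at this
      exact mul_ne_zero (sub_ne_zero.2 hk) (Finsupp.mem_support_iff.1 he) this.symm
  · push Not at hs
    refine ⟨d, ?_⟩
    have : Finsupp.single d 1 = (g d)⁻¹ • g := by
      ext x
      by_cases hx : x = d
      · subst hx
        simp [inv_mul_cancel₀ (Finsupp.mem_support_iff.1 hd)]
      · have : g x = 0 := by
          by_contra h0
          exact hx (hs x (Finsupp.mem_support_iff.2 h0))
        simp [this, Ne.symm hx]
    rw [this]
    exact N.smul_mem _ hg

/-- A family `D` of distributions that is killed by a nonzero polynomial in `x₁, x₂` vanishes,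
provided that `x₀` acts on it as `x₁ - x₂`, that an operator `T` (a translation) acts on it as
`∂/∂x₁ + ∂/∂x₂`, and that an operator `E` (a degree) acts on it as `c` plus the total degree. -/
lemma eq_zero_of_polyMul_eq_zero {D : W → FormalDistribution W}
    (hD : ∀ w l m n, D w (l + 1) m n = D w l (m + 1) n - D w l m (n + 1))
    (T E : Module.End ℂ W) (c : ℂ)
    (hT : ∀ w l m n, T (D w l m n) =
      D (T w) l m n - (m : ℂ) • D w l (m - 1) n - (n : ℂ) • D w l m (n - 1))
    (hE : ∀ w l m n, E (D w l m n) = D (E w) l m n + (c - l - m - n) • D w l m n)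
    {f : MvPolynomial (Fin 2) ℂ} (hf : f ≠ 0) (hfD : ∀ w, polyMul f (D w) = 0) (w : W) :
    D w = 0 := by
  -- the polynomials in `x₀, x₂` that kill the family, as functions on exponents
  let N : Submodule ℂ ((Fin 2 →₀ ℕ) →₀ ℂ) :=
    { carrier := {g | ∀ w l m n, (g.sum fun d c => c • D w (l + d 0) m (n + d 1)) = 0}
      zero_mem' := fun w l m n => by simp
      add_mem' := fun {g h} hg hh w l m n => by
        rw [Finsupp.sum_add_index' (by simp) (by simp [add_smul]), hg, hh, add_zero]
      smul_mem' := fun c g hg w l m n => by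
        rw [Finsupp.sum_smul_index (by simp)]
        simp only [mul_smul]
        rw [← Finsupp.smul_sum, hg, smul_zero] }
  have hsum : ∀ (g g' : (Fin 2 →₀ ℕ) →₀ ℂ) (φ : (Fin 2 →₀ ℕ) → ℂ), (∀ d, g' d = φ d * g d) →
      ∀ w l m n, (g'.sum fun d c => c • D w (l + d 0) m (n + d 1)) =
        ∑ d ∈ g.support, g d • φ d • D w (l + d 0) m (n + d 1) := by
    intro g g' φ h w l m n
    rw [Finsupp.sum_of_support_subset g' (s := g.support) _ _ (by simp)]
    · exact Finset.sum_congr rfl fun d _ => by rw [h, mul_comm, mul_smul]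
    · intro x hx
      rw [Finsupp.mem_support_iff, h] at hx
      exact Finsupp.mem_support_iff.2 (right_ne_zero_of_mul hx)
  -- multiplying the coefficients by the exponent of `x₂`: bracket the relation with `T`, which gives
  -- `∂/∂x₂` of the polynomial, and restore the exponent by replacing `n` with `n + 1`
  have hN1 : ∀ g ∈ N, ∀ g' : (Fin 2 →₀ ℕ) →₀ ℂ, (∀ d, g' d = (d 1 : ℂ) * g d) → g' ∈ N := by
    intro g hg g' hg' w l m n
    rw [hsum g g' _ hg']
    have e1 := congrArg T (hg w l m (n + 1))
    have e2 := hg (T w) l m (n + 1)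
    have e3 := hg w l (m - 1) (n + 1)
    have e4 := hg w l m n
    simp only [Finsupp.sum, map_sum, map_smul, hT, map_zero, smul_sub, Finset.sum_sub_distrib]
      at e1 e2 e3 e4
    simp only [smul_comm _ (m : ℂ), ← Finset.smul_sum, e2, e3, smul_zero, sub_zero, zero_sub,
      neg_eq_zero] at e1
    rw [← e1]
    have e5 : ((n : ℂ) + 1) • ∑ d ∈ g.support, g d • D w (l + d 0) m (n + d 1) = 0 := by
      rw [e4, smul_zero]
    rw [← add_zero (∑ d ∈ g.support, _), ← e5, Finset.smul_sum, ← Finset.sum_add_distrib]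
    refine Finset.sum_congr rfl fun d _ => ?_
    rw [show n + 1 + (d 1 : ℤ) - 1 = n + d 1 by ring]
    module
  -- multiplying by the exponent of `x₀`: bracketing with `E` gives the total degree, from which the
  -- contribution of `x₂` is subtracted
  have hN0 : ∀ g ∈ N, ∀ g' : (Fin 2 →₀ ℕ) →₀ ℂ, (∀ d, g' d = (d 0 : ℂ) * g d) → g' ∈ N := by
    intro g hg g' hg' w l m n
    let g₁ : (Fin 2 →₀ ℕ) →₀ ℂ := Finsupp.onFinset g.support (fun d => (d 1 : ℂ) * g d)
      (fun x hx => by simp only [Finsupp.mem_support_iff]; exact right_ne_zero_of_mul hx)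
    have e0 := hN1 g hg g₁ (fun _ => rfl) w l m n
    rw [hsum g g₁ _ (fun _ => rfl)] at e0
    rw [hsum g g' _ hg']
    have e1 := congrArg E (hg w l m n)
    have e2 := hg (E w) l m n
    have e4 := hg w l m n
    simp only [Finsupp.sum, map_sum, map_smul, hE, map_zero, smul_add, Finset.sum_add_distrib]
      at e1 e2 e4
    rw [e2, zero_add] at e1
    have key : ∑ d ∈ g.support, g d • (d 0 : ℂ) • D w (l + d 0) m (n + d 1) =
        (c - l - m - n) • (∑ d ∈ g.support, g d • D w (l + d 0) m (n + d 1)) -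
        (∑ d ∈ g.support, g d • (d 1 : ℂ) • D w (l + d 0) m (n + d 1)) -
        ∑ d ∈ g.support, g d • (c - ((l + d 0 : ℤ) : ℂ) - m - ((n + d 1 : ℤ) : ℂ)) •
          D w (l + d 0) m (n + d 1) := by
      rw [Finset.smul_sum, ← Finset.sum_sub_distrib, ← Finset.sum_sub_distrib]
      refine Finset.sum_congr rfl fun d _ => ?_
      push_cast
      module
    rw [key, e0, e1, e4, smul_zero, sub_zero, sub_zero]
  obtain ⟨d, hd⟩ := exists_single_mem (fun (k : Fin 2) (d : Fin 2 →₀ ℕ) => (d k : ℂ))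
    (fun d e h => by ext k; exact_mod_cast h k) N
    (fun g hg k g' hg' => by
      fin_cases k
      · exact hN0 g hg g' hg'
      · exact hN1 g hg g' hg')
    (AddMonoidAlgebra.coeff (substSum f)) (fun w l m n => by
      have := polyMul_eq_polyMul₀₂ (hD w) f l m n
      rw [hfD w] at this
      exact this.symm)
    (fun h => substSum_ne_zero hf (AddMonoidAlgebra.ext h))
  funext l m n
  simpa using hd w (l - d 0) m (n - d 1)

end Annihilation

section Covariance

variable {V W : Type*} [AddCommGroup V] [Module ℂ V] [AddCommGroup W] [Module ℂ W]
  {L : Fin 3 → Module.End ℂ V} {LW : Fin 3 → Module.End ℂ W} {Y : VertexMap V W}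

lemma IsSl2Covariant.translation (h : IsSl2Covariant L LW Y) (v : V) (n : ℤ) (w : W) :
    LW 0 (Y v n w) = Y v n (LW 0 w) - (n : ℂ) • Y v (n - 1) w := by
  have h1 := LinearMap.congr_fun (h.comm 0 v n) w
  rw [Fin.sum_univ_three] at h1
  simp [h.deriv, LieRing.of_associative_ring_bracket] at h1
  rw [sub_eq_iff_eq_add] at h1
  rw [h1]
  abel

lemma IsSl2Covariant.degree (h : IsSl2Covariant L LW Y) (v : V) (n : ℤ) (w : W) :
    LW 1 (Y v n w) = Y v n (LW 1 w) + Y (L 1 v) n w - ((n : ℂ) + 1) • Y v n w := by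
  have h1 := LinearMap.congr_fun (h.comm 1 v n) w
  rw [Fin.sum_univ_three] at h1
  simp [h.deriv, LieRing.of_associative_ring_bracket] at h1
  rw [sub_eq_iff_eq_add] at h1
  rw [h1]
  module

end Covariance

namespace MobiusVertexAlgebra

variable {V : Type*} [AddCommGroup V] [Module ℂ V] (A : MobiusVertexAlgebra V)

lemma mem_wt_of_eigenvector {n : ℤ} {v : V} (h : A.L 1 v = (n : ℂ) • v) : v ∈ A.wt n := by
  classical
  let := A.isInternal.chooseDecomposition
  have hcomm : ∀ x : V, ∀ k, (DirectSum.decompose A.wt (A.L 1 x) k : V) =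
      (k : ℂ) • (DirectSum.decompose A.wt x k : V) := by
    intro x k
    induction x using DirectSum.Decomposition.inductionOn A.wt with
    | zero => simp
    | @homogeneous i m =>
      rw [A.weight i m m.2, DirectSum.decompose_smul]
      by_cases hik : i = k
      · subst hik; simp [DirectSum.smul_apply]
      · simp [DirectSum.smul_apply, DirectSum.of_eq_of_ne _ _ _ (Ne.symm hik)]
    | add x y hx hy => simp [DirectSum.decompose_add, hx, hy]
  have hz : ∀ k, k ≠ n → (DirectSum.decompose A.wt v k : V) = 0 := by
    intro k hk
    have := hcomm v k
    rw [h, DirectSum.decompose_smul] at this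
    have h2 : ((n : ℂ) - k) • (DirectSum.decompose A.wt v k : V) = 0 := by
      rw [sub_smul, ← this, DirectSum.smul_apply]
      simp
    exact (smul_eq_zero.1 h2).resolve_left (sub_ne_zero.2 (by exact_mod_cast hk.symm))
  have : v = (DirectSum.decompose A.wt v n : V) := by
    conv_lhs => rw [← DirectSum.sum_support_decompose A.wt v]
    by_cases hn : n ∈ (DirectSum.decompose A.wt v).support
    · exact Finset.sum_eq_single_of_mem n hn fun k _ hk => hz k hk
    · rw [DFinsupp.notMem_support_iff.1 hn]
      exact Finset.sum_eq_zero fun k hk => hz k (fun e => hn (e ▸ hk))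
  rw [this]
  exact Subtype.coe_prop _

lemma degree_mode {a b : ℤ} {u v : V} (hu : u ∈ A.wt a) (hv : v ∈ A.wt b) (n : ℤ) :
    A.L 1 (A.Y u n v) = ((a + b - n - 1 : ℤ) : ℂ) • A.Y u n v := by
  rw [A.covariant.degree, A.weight a u hu, A.weight b v hv]
  simp only [map_smul, Pi.smul_apply, LinearMap.smul_apply]
  push_cast
  module

lemma mode_mem_wt {a b : ℤ} {u v : V} (hu : u ∈ A.wt a) (hv : v ∈ A.wt b) (n : ℤ) :
    A.Y u n v ∈ A.wt (a + b - n - 1) :=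
  A.mem_wt_of_eigenvector (A.degree_mode hu hv n)

lemma translation_mem_wt {a : ℤ} {v : V} (hv : v ∈ A.wt a) : A.L 0 v ∈ A.wt (a + 1) := by
  apply A.mem_wt_of_eigenvector
  have h := LinearMap.congr_fun A.sl2.zero_neg v
  rw [LieRing.of_associative_ring_bracket, LinearMap.sub_apply, Module.End.mul_apply,
    Module.End.mul_apply, A.weight a v hv, map_smul, sub_eq_iff_eq_add] at h
  rw [h]
  push_cast
  module

end MobiusVertexAlgebra

section Defect

variable {V W : Type*} [AddCommGroup V] [Module ℂ V] [AddCommGroup W] [Module ℂ W]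

lemma jacobiFst_eq (Y : VertexMap V W) (u v : V) (w : W) (l m n : ℤ) :
    jacobiFst Y u v w l m n = binomConv (fun i j => Y u i (Y v j w)) l m n := rfl

/-- The second term of the Jacobi identity is obtained from the first by exchanging
`(u,x₁)` and `(v,x₂)`, and `x₀` with `-x₀`. -/
lemma jacobiSnd_eq (Y : VertexMap V W) (u v : V) (w : W) (l m n : ℤ) :
    jacobiSnd Y u v w l m n =
      ((-1 : ℂ) ^ l) • binomConv (fun j i => Y v j (Y u i w)) l n m := by
  rw [jacobiSnd, binomConv, smul_finsum]
  refine finsum_congr fun k => ?_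
  rw [smul_smul, zpow_add₀ (by norm_num), zpow_natCast, mul_assoc]

/-- The iterate term of the Jacobi identity has the form of the first term, with the roles of
`x₀` and `x₁` exchanged: up to signs, `(x₁ - x₀)^m` takes the place of `(x₁ - x₂)^l`. -/
lemma jacobiIter_eq (Y : VertexMap V V) (YW : VertexMap V W) (u v : V) (w : W) (l m n : ℤ) :
    jacobiIter Y YW u v w l m n =
      ((-1 : ℂ) ^ l) • binomConv (fun j i => ((-1 : ℂ) ^ i) • YW (Y u i v) j w) m n l := by
  rw [jacobiIter, binomConv, smul_finsum]
  refine finsum_congr fun k => ?_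
  rw [smul_smul, smul_smul, zpow_add₀ (by norm_num), zpow_natCast, add_comm n m]
  congr 1
  have h1 : ((-1 : ℂ) ^ l) * (-1) ^ l = 1 := by rw [← mul_zpow]; simp
  have h2 : ((-1 : ℂ) ^ k) * (-1) ^ k = 1 := by rw [← mul_pow]; simp
  linear_combination (-((Ring.choose m k : ℤ) : ℂ)) * h2 -
    ((-1 : ℂ) ^ k * (-1) ^ k * (Ring.choose m k : ℤ)) * h1

end Defect

namespace Quasimodule

variable {V : Type*} [AddCommGroup V] [Module ℂ V] {A : MobiusVertexAlgebra V}
  {W : Type*} [AddCommGroup W] [Module ℂ W] (M : Quasimodule A W)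

/-- The difference of the two sides of the Jacobi identity. -/
def jacobiDefect (u v : V) (w : W) : FormalDistribution W :=
  jacobiFst M.Y u v w - jacobiSnd M.Y u v w - jacobiIter A.Y M.Y u v w

lemma isTruncated_mul (u v : V) (w : W) : IsTruncated fun i j => M.Y u i (M.Y v j w) := by
  obtain ⟨N, hN⟩ := M.truncation v w
  exact ⟨N, fun j hj i => by simp [hN j hj]⟩

lemma isTruncated_iter (u v : V) (w : W) :
    IsTruncated fun j i => ((-1 : ℂ) ^ i) • M.Y (A.Y u i v) j w := by
  obtain ⟨N, hN⟩ := A.truncation u v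
  exact ⟨N, fun j hj i => by simp [hN j hj]⟩

lemma jacobiDefect_succ (u v : V) (w : W) (l m n : ℤ) :
    M.jacobiDefect u v w (l + 1) m n =
      M.jacobiDefect u v w l (m + 1) n - M.jacobiDefect u v w l m (n + 1) := by
  simp only [jacobiDefect, Pi.sub_apply, jacobiFst_eq, jacobiSnd_eq, jacobiIter_eq,
    binomConv_succ (M.isTruncated_mul _ _ _), binomConv_succ (M.isTruncated_iter _ _ _),
    zpow_add_one₀ (show (-1 : ℂ) ≠ 0 by norm_num)]
  module

end Quasimodule

section
variable {W : Type*} [AddCommGroup W] [Module ℂ W]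

lemma IsTruncated.smul_shift {a : ℤ → ℤ → W} (ha : IsTruncated a) (c : ℤ → ℤ → ℂ) (s t : ℤ) :
    IsTruncated fun i j => c i j • a (i - s) (j - t) := by
  obtain ⟨N, hN⟩ := ha
  exact ⟨N + t, fun j hj i => by simp [hN (j - t) (by omega)]⟩

lemma binomConv_smul {a : ℤ → ℤ → W} (ha : IsTruncated a) (c : ℂ) (l m n : ℤ) :
    binomConv (fun i j => c • a i j) l m n = c • binomConv a l m n :=
  (binomConv_map ha (c • LinearMap.id) l m n).symm

/-- If an operator acts on the generating series `a` by a translation in both variables, then it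
does so on `(x₁ - x₂)^l a`. -/
lemma binomConv_translation {a a' : ℤ → ℤ → W} (ha : IsTruncated a) (ha' : IsTruncated a')
    (T : Module.End ℂ W)
    (hT : ∀ i j, T (a i j) = a' i j - (i : ℂ) • a (i - 1) j - (j : ℂ) • a i (j - 1)) (l m n : ℤ) :
    T (binomConv a l m n) = binomConv a' l m n - (m : ℂ) • binomConv a l (m - 1) n -
      (n : ℂ) • binomConv a l m (n - 1) := by
  have h1 : IsTruncated fun i j => (i : ℂ) • a (i - 1) j := by
    simpa using ha.smul_shift (fun i _ => (i : ℂ)) 1 0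
  have h2 : IsTruncated fun i j => (j : ℂ) • a i (j - 1) := by
    simpa using ha.smul_shift (fun _ j => (j : ℂ)) 0 1
  have h3 : (fun i j => T (a i j)) = fun i j => a' i j +
      (-1 : ℂ) • ((i : ℂ) • a (i - 1) j + (j : ℂ) • a i (j - 1)) := by
    funext i j
    rw [hT]
    module
  have h12 : IsTruncated fun i j => (i : ℂ) • a (i - 1) j + (j : ℂ) • a i (j - 1) := by
    obtain ⟨N, hN⟩ := h1
    obtain ⟨N', hN'⟩ := h2
    refine ⟨max N N', fun j hj i => ?_⟩
    beta_reduce at hN hN' ⊢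
    rw [hN j ((le_max_left _ _).trans hj), hN' j ((le_max_right _ _).trans hj), add_zero]
  have h12' : IsTruncated fun i j =>
      (-1 : ℂ) • ((i : ℂ) • a (i - 1) j + (j : ℂ) • a i (j - 1)) := by
    simpa using h12.smul_shift (fun _ _ => -1) 0 0
  rw [binomConv_map ha, h3, binomConv_add ha' h12', binomConv_smul h12, binomConv_add h1 h2,
    binomConv_deriv_fst ha, binomConv_deriv_snd ha]
  module

/-- The analogue of `binomConv_translation` for a translation in the first variable only. -/
lemma binomConv_translation_fst {a a' : ℤ → ℤ → W} (ha : IsTruncated a) (ha' : IsTruncated a')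
    (T : Module.End ℂ W)
    (hT : ∀ i j, T (a i j) = a' i j - (i : ℂ) • a (i - 1) j) (l m n : ℤ) :
    T (binomConv a l m n) = binomConv a' l m n - (m : ℂ) • binomConv a l (m - 1) n -
      (l : ℂ) • binomConv a (l - 1) m n := by
  have h1 : IsTruncated fun i j => (i : ℂ) • a (i - 1) j := by
    simpa using ha.smul_shift (fun i _ => (i : ℂ)) 1 0
  have h1' : IsTruncated fun i j => (-1 : ℂ) • (i : ℂ) • a (i - 1) j := by
    simpa using h1.smul_shift (fun _ _ => -1) 0 0
  have h3 : (fun i j => T (a i j)) = fun i j => a' i j + (-1 : ℂ) • (i : ℂ) • a (i - 1) j := by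
    funext i j
    rw [hT]
    module
  rw [binomConv_map ha, h3, binomConv_add ha' h1', binomConv_smul h1, binomConv_deriv_fst ha]
  module

/-- If an operator acts on the coefficients of `a` by `c - i - j`, then it acts on those of
`(x₁ - x₂)^l a` by `c - l - m - n`. -/
lemma binomConv_degree {a a' : ℤ → ℤ → W} (ha : IsTruncated a) (ha' : IsTruncated a')
    (E : Module.End ℂ W) (c : ℂ)
    (hE : ∀ i j, E (a i j) = a' i j + (c - i - j) • a i j) (l m n : ℤ) :
    E (binomConv a l m n) = binomConv a' l m n + (c - l - m - n) • binomConv a l m n := by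
  obtain ⟨N, hN⟩ := ha
  obtain ⟨N', hN'⟩ := ha'
  obtain ⟨K, hK⟩ := exists_le_add_natCast (max N N') n
  have := le_max_left N N'
  have := le_max_right N N'
  rw [binomConv_eq_sum hN _ _ _ K (by omega), binomConv_eq_sum hN' _ _ _ K (by omega), map_sum,
    Finset.smul_sum, ← Finset.sum_add_distrib]
  refine Finset.sum_congr rfl fun k _ => ?_
  rw [map_smul, hE]
  push_cast
  module

end

namespace Quasimodule

variable {V : Type*} [AddCommGroup V] [Module ℂ V] {A : MobiusVertexAlgebra V}
  {W : Type*} [AddCommGroup W] [Module ℂ W] (M : Quasimodule A W)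

lemma translation_jacobiDefect (u v : V) (w : W) (l m n : ℤ) :
    M.L 0 (M.jacobiDefect u v w l m n) = M.jacobiDefect u v (M.L 0 w) l m n -
      (m : ℂ) • M.jacobiDefect u v w l (m - 1) n - (n : ℂ) • M.jacobiDefect u v w l m (n - 1) := by
  have hmul : ∀ (u v : V) (i j : ℤ), M.L 0 (M.Y u i (M.Y v j w)) = M.Y u i (M.Y v j (M.L 0 w)) -
      (i : ℂ) • M.Y u (i - 1) (M.Y v j w) - (j : ℂ) • M.Y u i (M.Y v (j - 1) w) := by
    intro u v i j
    rw [M.covariant.translation, M.covariant.translation, map_sub, map_smul]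
    abel
  have hiter : ∀ j i : ℤ, M.L 0 (((-1 : ℂ) ^ i) • M.Y (A.Y u i v) j w) =
      ((-1 : ℂ) ^ i) • M.Y (A.Y u i v) j (M.L 0 w) -
        (j : ℂ) • ((-1 : ℂ) ^ i) • M.Y (A.Y u i v) (j - 1) w := by
    intro j i
    rw [map_smul, M.covariant.translation]
    module
  simp only [jacobiDefect, Pi.sub_apply, map_sub, map_smul, jacobiFst_eq, jacobiSnd_eq,
    jacobiIter_eq,
    binomConv_translation (M.isTruncated_mul _ _ _) (M.isTruncated_mul _ _ _) _ (hmul _ _),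
    binomConv_translation_fst (M.isTruncated_iter _ _ _) (M.isTruncated_iter _ _ _) _ hiter]
  module

lemma degree_jacobiDefect {a b : ℤ} {u v : V} (hu : u ∈ A.wt a) (hv : v ∈ A.wt b) (w : W)
    (l m n : ℤ) :
    M.L 1 (M.jacobiDefect u v w l m n) = M.jacobiDefect u v (M.L 1 w) l m n +
      ((a + b - 2 : ℂ) - l - m - n) • M.jacobiDefect u v w l m n := by
  have hmul : ∀ {a b : ℤ} {u v : V} (hu : u ∈ A.wt a) (hv : v ∈ A.wt b) (i j : ℤ),
      M.L 1 (M.Y u i (M.Y v j w)) = M.Y u i (M.Y v j (M.L 1 w)) +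
        ((a + b - 2 : ℂ) - i - j) • M.Y u i (M.Y v j w) := by
    intro a b u v hu hv i j
    rw [M.covariant.degree, M.covariant.degree, A.weight a u hu, A.weight b v hv]
    simp only [map_smul, Pi.smul_apply, LinearMap.smul_apply, map_add, map_sub]
    module
  have hiter : ∀ j i : ℤ, M.L 1 (((-1 : ℂ) ^ i) • M.Y (A.Y u i v) j w) =
      ((-1 : ℂ) ^ i) • M.Y (A.Y u i v) j (M.L 1 w) +
        ((a + b - 2 : ℂ) - j - i) • ((-1 : ℂ) ^ i) • M.Y (A.Y u i v) j w := by
    intro j i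
    rw [map_smul, M.covariant.degree, A.degree_mode hu hv]
    simp only [map_smul, Pi.smul_apply, LinearMap.smul_apply]
    push_cast
    module
  simp only [jacobiDefect, Pi.sub_apply, map_sub, map_smul, jacobiFst_eq, jacobiSnd_eq,
    jacobiIter_eq,
    binomConv_degree (M.isTruncated_mul _ _ _) (M.isTruncated_mul _ _ _) _ _ (hmul hu hv),
    binomConv_degree (M.isTruncated_mul _ _ _) (M.isTruncated_mul _ _ _) _ _ (hmul hv hu),
    binomConv_degree (M.isTruncated_iter _ _ _) (M.isTruncated_iter _ _ _) _ _ hiter]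
  module

/-- For homogeneous vectors a quasimodule satisfies the Jacobi identity itself: the bracket relations
with `L(-1)` and `L(0)` force a Jacobi defect that is killed by a nonzero polynomial to vanish. -/
theorem jacobi {a b : ℤ} {u v : V} (hu : u ∈ A.wt a) (hv : v ∈ A.wt b) (w : W) :
    jacobiFst M.Y u v w - jacobiSnd M.Y u v w = jacobiIter A.Y M.Y u v w := by
  obtain ⟨f, hf, hfD⟩ := M.quasiJacobi u v
  refine sub_eq_zero.1 (eq_zero_of_polyMul_eq_zero (D := M.jacobiDefect u v)
    (M.jacobiDefect_succ u v) (M.L 0) (M.L 1) _ (M.translation_jacobiDefect u v)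
    (M.degree_jacobiDefect hu hv) hf (fun w => ?_) w)
  rw [← sub_eq_zero.2 (hfD w)]
  funext l m n
  simp [polyMul, jacobiDefect, smul_sub]

/-- The commutator formula, with the sum cut off where `u_k v` vanishes. -/
lemma commutator {a b : ℤ} {u v : V} (hu : u ∈ A.wt a) (hv : v ∈ A.wt b) (m n : ℤ) (w : W)
    {K : ℕ} (hK : ∀ k : ℤ, K ≤ k → A.Y u k v = 0) :
    M.Y u m (M.Y v n w) - M.Y v n (M.Y u m w) =
      ∑ k ∈ Finset.range K, ((Ring.choose m k : ℤ) : ℂ) • M.Y (A.Y u k v) (m + n - k) w := by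
  have h := congrFun (congrFun (congrFun (M.jacobi hu hv w) 0) m) n
  rw [Pi.sub_apply, Pi.sub_apply, Pi.sub_apply, jacobiFst, jacobiSnd, jacobiIter,
    finsum_eq_single _ 0, finsum_eq_single _ 0] at h
  · simp only [zero_add, add_zero, sub_zero, Nat.cast_zero, pow_zero, Ring.choose_zero_right,
      Int.cast_one, mul_one, one_smul, zpow_zero] at h
    rw [h]
    refine finsum_eq_sum_of_support_subset _ fun k hk => ?_
    by_contra hc
    simp only [Finset.coe_range, Set.mem_Iio, not_lt] at hc
    exact hk (by simp [hK k (by omega)])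
  · intro k hk
    simp [Ring.choose_zero_pos ℤ (Nat.pos_of_ne_zero hk)]
  · intro k hk
    simp [Ring.choose_zero_pos ℤ (Nat.pos_of_ne_zero hk)]

/-- The iterate formula. -/
lemma iterate {a b : ℤ} {u v : V} (hu : u ∈ A.wt a) (hv : v ∈ A.wt b) (l n : ℤ) (w : W) :
    M.Y (A.Y u l v) n w =
      (∑ᶠ k : ℕ, ((-1 : ℂ) ^ k * ((Ring.choose l k : ℤ) : ℂ)) •
          M.Y u (l - k) (M.Y v (n + k) w)) -
        ∑ᶠ k : ℕ, ((-1 : ℂ) ^ (l + k) * ((Ring.choose l k : ℤ) : ℂ)) •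
          M.Y v (n + l - k) (M.Y u k w) := by
  have h := congrFun (congrFun (congrFun (M.jacobi hu hv w) l) 0) n
  rw [Pi.sub_apply, Pi.sub_apply, Pi.sub_apply, jacobiFst, jacobiSnd, jacobiIter,
    finsum_eq_single (fun k : ℕ => ((Ring.choose 0 k : ℤ) : ℂ) • _) 0] at h
  · simpa using h.symm
  · intro k hk
    simp [Ring.choose_zero_pos ℤ (Nat.pos_of_ne_zero hk)]

end Quasimodule

/-! ### Commuting fields with finite-dimensional coefficient algebra -/

section LaurentIntegral

open LaurentPolynomial

lemma LaurentPolynomial.coeff_mul_eq_finsum {R : Type*} [Semiring R] (p q : R[T;T⁻¹]) (i : ℤ) :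
    (p * q).coeff i = ∑ᶠ j : ℤ, p.coeff j * q.coeff (i - j) := by
  rw [AddMonoidAlgebra.coeff_mul, finsum_eq_sum_of_support_subset (s := p.coeff.support)]
  · refine Finset.sum_congr rfl fun j _ => ?_
    dsimp only [Finsupp.sum]
    rw [Finset.sum_eq_single (i - j)]
    · simp
    · intro k _ hk
      exact if_neg fun h => hk (by omega)
    · intro h
      simp [Finsupp.notMem_support_iff.1 h]
  · intro j hj
    exact Finsupp.mem_support_iff.2 (left_ne_zero_of_mul hj)

/-- The coefficients of an integral Laurent polynomial are integral. -/
lemma LaurentPolynomial.isIntegral_coeff {k R : Type*} [CommRing k] [CommRing R] [Algebra k R]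
    {q : R[T;T⁻¹]} (hq : IsIntegral k q) (i : ℤ) : IsIntegral k (q.coeff i) := by
  let _ : Algebra (Polynomial k) (Polynomial R) := Polynomial.algebra k R
  obtain ⟨f, hf, hfq⟩ := hq
  obtain ⟨n, p, hp⟩ := q.exists_T_pow
  -- multiplying by a power of `T` gives a polynomial `p`, integral over `k[X]`
  let φ : Polynomial k →+* R[T;T⁻¹] :=
    Polynomial.toLaurent.comp (Polynomial.mapRingHom (algebraMap k R))
  have h1 : Polynomial.eval₂ φ q (f.map Polynomial.C) = 0 := by
    rw [Polynomial.eval₂_map, ← hfq]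
    congr 1
    ext c
    simp [φ, LaurentPolynomial.algebraMap_apply]
  have h2 := Polynomial.scaleRoots_eval₂_eq_zero φ (s := Polynomial.X ^ n) h1
  have h3 : φ (Polynomial.X ^ n) * q = Polynomial.toLaurent p := by
    rw [hp]
    simp [φ, mul_comm]
  rw [h3] at h2
  have hpint : IsIntegral (Polynomial k) p := by
    refine ⟨(f.map Polynomial.C).scaleRoots (Polynomial.X ^ n), ?_, ?_⟩
    · exact (Polynomial.monic_scaleRoots_iff _).2 (hf.map _)
    · apply Polynomial.toLaurent_injective
      rw [Polynomial.hom_eval₂, map_zero]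
      exact h2
  have h4 : q.coeff i = (Polynomial.toLaurent p).coeff (i + n) := by
    rw [hp, T, AddMonoidAlgebra.coeff_mul_single_eq_coeff_mul i (fun _ _ => by omega), mul_one]
  rw [h4, LaurentPolynomial.coeff_toLaurent]
  by_cases h5 : i + n ∈ Set.range (Nat.castEmbedding : ℕ ↪ ℤ)
  · obtain ⟨j, hj⟩ := h5
    rw [← hj, Finsupp.mapDomain_apply Nat.castEmbedding.injective]
    exact Polynomial.isIntegral_iff_isIntegral_coeff.1 hpint j
  · rw [Finsupp.mapDomain_of_notMem_range _ _ h5]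
    exact isIntegral_zero

end LaurentIntegral

section CommutingFields

open LaurentPolynomial

/-- Let `θ` be a linear map to the Laurent polynomials over a commutative algebra `R`, whose range
is a finite-dimensional subalgebra. If `R` is generated by the coefficients of the elements of the
range, then `R` is finite-dimensional. -/
lemma finite_of_laurentPolynomial {V R : Type*} [AddCommGroup V] [Module ℂ V] [CommRing R]
    [Algebra ℂ R] (θ : V →ₗ[ℂ] R[T;T⁻¹]) [FiniteDimensional ℂ (LinearMap.range θ)]
    (hone : 1 ∈ LinearMap.range θ) (hmul : ∀ u v, θ u * θ v ∈ LinearMap.range θ)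
    (hgen : Algebra.adjoin ℂ {a | ∃ v i, (θ v).coeff i = a} = ⊤) : Module.Finite ℂ R := by
  let E : Subalgebra ℂ R[T;T⁻¹] := Submodule.toSubalgebra (LinearMap.range θ) hone (by
    rintro _ _ ⟨u, rfl⟩ ⟨v, rfl⟩
    exact hmul u v)
  have hfg : (LinearMap.range θ).FG := Module.Finite.iff_fg.1 inferInstance
  have hE : E.toSubmodule.FG := by
    have : E.toSubmodule = LinearMap.range θ := by ext; rfl
    rwa [this]
  obtain ⟨s, hs⟩ := hfg
  -- finitely many coefficients, those of a spanning set of the range, generate `R`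
  let t : Set R := ⋃ q ∈ s, (fun i => AddMonoidAlgebra.coeff q i) ''
    ((AddMonoidAlgebra.coeff q).support : Set ℤ)
  have ht : t.Finite := s.finite_toSet.biUnion fun q _ => (Finset.finite_toSet _).image _
  have htint : ∀ x ∈ t, IsIntegral ℂ x := by
    intro x hx
    simp only [t, Set.mem_iUnion, Set.mem_image] at hx
    obtain ⟨q, hq, i, -, rfl⟩ := hx
    refine LaurentPolynomial.isIntegral_coeff (IsIntegral.of_mem_of_fg E hE q ?_) i
    change q ∈ LinearMap.range θ
    rw [← hs]
    exact Submodule.subset_span hq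
  have htop : Algebra.adjoin ℂ t = ⊤ := by
    rw [eq_top_iff, ← hgen]
    refine Algebra.adjoin_le ?_
    rintro _ ⟨v, i, rfl⟩
    have hv : θ v ∈ Submodule.span ℂ (s : Set R[T;T⁻¹]) := hs ▸ LinearMap.mem_range_self θ v
    generalize θ v = q at hv
    induction hv using Submodule.span_induction with
    | mem q hq =>
      by_cases h0 : q.coeff i = 0
      · rw [h0]; exact Subalgebra.zero_mem _
      · refine Algebra.subset_adjoin ?_
        simp only [t, Set.mem_iUnion]
        exact ⟨q, hq, i, Finsupp.mem_support_iff.2 h0, rfl⟩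
    | zero => exact Subalgebra.zero_mem _
    | add p q _ _ hp hq => exact Subalgebra.add_mem _ hp hq
    | smul c p _ hp => exact Subalgebra.smul_mem _ hp c
  have := fg_adjoin_of_finite ht htint
  rw [htop] at this
  exact ⟨by simpa using this⟩

/-- A commutative algebra is finite-dimensional if it is generated by the coefficients of fields
`∑ r v m x^(-m-1)`, each a Laurent polynomial, that depend on `v` through a finite-dimensional
quotient and are closed under products. -/
lemma finite_of_fields {V R : Type*} [AddCommGroup V] [Module ℂ V] [CommRing R] [Algebra ℂ R]
    (r : V →ₗ[ℂ] (ℤ → R)) (H : Set V) (hH : Submodule.span ℂ H = ⊤)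
    (hfin : ∀ v, (Function.support (r v)).Finite)
    (hone : ∃ v, ∀ m, r v m = if m = -1 then 1 else 0)
    (hmul : ∀ u ∈ H, ∀ v ∈ H, ∃ w, ∀ m, r w m = ∑ᶠ i : ℤ, r u i * r v (m - 1 - i))
    (C : Submodule ℂ V) [FiniteDimensional ℂ (V ⧸ C)] (hC : ∀ v ∈ C, r v = 0)
    (hgen : Algebra.adjoin ℂ {a | ∃ v m, r v m = a} = ⊤) : Module.Finite ℂ R := by
  have hmem : ∀ v, v ∈ Submodule.span ℂ H := fun v => hH ▸ Submodule.mem_top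
  have hr : ∀ v, (Function.support fun i => r v (-i - 1)).Finite := fun v =>
    ((hfin v).image fun m => -m - 1).subset fun i hi => ⟨-i - 1, hi, by ring⟩
  let θ : V →ₗ[ℂ] R[T;T⁻¹] :=
    { toFun := fun v => .ofCoeff (Finsupp.ofSupportFinite _ (hr v))
      map_add' := fun u v => by
        ext i
        simp [Finsupp.ofSupportFinite_coe]
      map_smul' := fun c v => by
        ext i
        simp [Finsupp.ofSupportFinite_coe] }
  have hθ : ∀ v i, (θ v).coeff i = r v (-i - 1) := fun v i => rfl
  have hker : C ≤ LinearMap.ker θ := by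
    intro v hv
    rw [LinearMap.mem_ker]
    ext i
    rw [hθ, hC v hv]
    rfl
  have : FiniteDimensional ℂ (LinearMap.range θ) := by
    rw [← Submodule.range_liftQ C θ hker]
    infer_instance
  refine finite_of_laurentPolynomial θ ?_ ?_ ?_
  · obtain ⟨v, hv⟩ := hone
    refine ⟨v, LaurentPolynomial.ext fun i => ?_⟩
    rw [hθ, ← T_zero, T_apply, hv]
    exact if_congr (by omega) rfl rfl
  · intro u v
    induction hmem u using Submodule.span_induction with
    | mem u hu =>
      induction hmem v using Submodule.span_induction with
      | mem v hv =>
        obtain ⟨w, hw⟩ := hmul u hu v hv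
        refine ⟨w, LaurentPolynomial.ext fun i => ?_⟩
        rw [LaurentPolynomial.coeff_mul_eq_finsum, hθ, hw]
        refine finsum_eq_of_bijective (fun j : ℤ => -j - 1)
          ⟨fun a b h => by simpa using h, fun b => ⟨-b - 1, by ring⟩⟩ fun j => ?_
        rw [hθ, hθ]
        ring_nf
      | zero => simp
      | add v w _ _ hv hw => rw [map_add, mul_add]; exact Submodule.add_mem _ hv hw
      | smul c v _ hv => rw [map_smul, mul_smul_comm]; exact Submodule.smul_mem _ _ hv
    | zero => simp
    | add v w _ _ hv hw => rw [map_add, add_mul]; exact Submodule.add_mem _ hv hw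
    | smul c v _ hv => rw [map_smul, smul_mul_assoc]; exact Submodule.smul_mem _ _ hv
  · rw [← hgen]
    congr 1
    ext a
    constructor
    · rintro ⟨v, i, rfl⟩
      exact ⟨v, -i - 1, rfl⟩
    · rintro ⟨v, m, rfl⟩
      exact ⟨v, -m - 1, by rw [hθ, show -(-m - 1) - 1 = m by ring]⟩

open scoped IsMulCommutative in
/-- A space with commuting fields `∑ ρ v m x^(-m-1)`, each a Laurent polynomial, is
finite-dimensional if it is generated by a finite set, if the fields depend on `v` through a
finite-dimensional quotient, and if products of fields are again fields. -/
lemma finiteDimensional_of_commuting_fields {V X : Type*} [AddCommGroup V] [Module ℂ V]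
    [AddCommGroup X] [Module ℂ X] (ρ : V →ₗ[ℂ] (ℤ → Module.End ℂ X))
    (H : Set V) (hH : Submodule.span ℂ H = ⊤)
    (hcomm : ∀ u ∈ H, ∀ v ∈ H, ∀ m n, ρ u m * ρ v n = ρ v n * ρ u m)
    (hfin : ∀ v ∈ H, (Function.support (ρ v)).Finite)
    (hone : ∃ v, ∀ m, ρ v m = if m = -1 then 1 else 0)
    (hmul : ∀ u ∈ H, ∀ v ∈ H, ∃ w, ∀ m, ρ w m = ∑ᶠ i : ℤ, ρ u i * ρ v (m - 1 - i))
    (C : Submodule ℂ V) [FiniteDimensional ℂ (V ⧸ C)] (hC : ∀ v ∈ C, ρ v = 0)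
    (S : Set X) (hS : S.Finite)
    (hgen : ∀ N : Submodule ℂ X, S ⊆ N → (∀ v ∈ H, ∀ m, ∀ x ∈ N, ρ v m x ∈ N) → N = ⊤) :
    FiniteDimensional ℂ X := by
  have hmem : ∀ v, v ∈ Submodule.span ℂ H := fun v => hH ▸ Submodule.mem_top
  have hcomm' : ∀ u v m n, ρ u m * ρ v n = ρ v n * ρ u m := by
    intro u v m n
    induction hmem u using Submodule.span_induction with
    | mem u hu =>
      induction hmem v using Submodule.span_induction with
      | mem v hv => exact hcomm u hu v hv m n
      | zero => simp
      | add v w _ _ hv hw => simp [mul_add, add_mul, hv, hw]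
      | smul c v _ hv => simp [hv]
    | zero => simp
    | add v w _ _ hv hw => simp [mul_add, add_mul, hv, hw]
    | smul c v _ hv => simp [hv]
  have hfin' : ∀ v, (Function.support (ρ v)).Finite := by
    intro v
    induction hmem v using Submodule.span_induction with
    | mem v hv => exact hfin v hv
    | zero => simp
    | add u v _ _ hu hv =>
      rw [map_add]
      exact (hu.union hv).subset (Function.support_add _ _)
    | smul c v _ hv =>
      rw [map_smul]
      exact hv.subset (Function.support_const_smul_subset _ _)
  let B : Set (Module.End ℂ X) := {T | ∃ v m, ρ v m = T}
  let R := Algebra.adjoin ℂ B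
  have : IsMulCommutative R := Algebra.isMulCommutative_adjoin ℂ (by
    rintro _ ⟨u, m, rfl⟩ _ ⟨v, n, rfl⟩
    exact hcomm' u v m n)
  let r : V →ₗ[ℂ] (ℤ → R) :=
    { toFun := fun v m => ⟨ρ v m, Algebra.subset_adjoin ⟨v, m, rfl⟩⟩
      map_add' := fun u v => by
        funext m
        exact Subtype.ext (by simp)
      map_smul' := fun c v => by
        funext m
        exact Subtype.ext (by simp) }
  have hR : Module.Finite ℂ R := by
    refine finite_of_fields r H hH (fun v => ?_) ?_ ?_ C (fun v hv => ?_) ?_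
    · exact (hfin' v).subset fun m hm h => hm (Subtype.ext h)
    · obtain ⟨v, hv⟩ := hone
      refine ⟨v, fun m => Subtype.ext ?_⟩
      change ρ v m = _
      rw [hv]
      split_ifs <;> rfl
    · intro u hu v hv
      obtain ⟨w, hw⟩ := hmul u hu v hv
      refine ⟨w, fun m => Subtype.ext ?_⟩
      exact (hw m).trans (AddMonoidHom.map_finsum_of_injective R.val.toLinearMap.toAddMonoidHom
        Subtype.val_injective fun i => r u i * r v (m - 1 - i)).symm
    · funext m
      exact Subtype.ext (congrFun (hC v hv) m)
    · rw [← Algebra.adjoin_adjoin_coe_preimage (s := B)]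
      congr 1
      ext a
      exact ⟨fun ⟨v, m, h⟩ => ⟨v, m, congrArg Subtype.val h⟩,
        fun ⟨v, m, h⟩ => ⟨v, m, Subtype.ext h⟩⟩
  have hX : Submodule.span R S = ⊤ := by
    have := hgen ((Submodule.span R S).restrictScalars ℂ) Submodule.subset_span
      (fun v _ m x hx => Submodule.smul_mem _ (r v m) hx)
    exact (Submodule.restrictScalars_eq_top_iff ℂ R X).1 this
  have : Module.Finite R X := ⟨⟨hS.toFinset, by simpa using hX⟩⟩
  exact Module.Finite.trans R X

end CommutingFields

/-! ### The weight filtration of a quasimodule -/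

namespace MobiusVertexAlgebra

variable {V : Type*} [AddCommGroup V] [Module ℂ V] (A : MobiusVertexAlgebra V)

/-- The homogeneous vectors. -/
def homogeneous : Set V := {v | ∃ a : ℤ, v ∈ A.wt a}

lemma span_homogeneous : Submodule.span ℂ A.homogeneous = ⊤ := by
  rw [eq_top_iff, ← A.isInternal.submodule_iSup_eq_top, iSup_le_iff]
  exact fun a v hv => Submodule.subset_span ⟨a, hv⟩

lemma mem_span_homogeneous (v : V) : v ∈ Submodule.span ℂ A.homogeneous :=
  A.span_homogeneous ▸ Submodule.mem_top

end MobiusVertexAlgebra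

namespace Quasimodule

variable {V : Type*} [AddCommGroup V] [Module ℂ V] {A : MobiusVertexAlgebra V}
  {W : Type*} [AddCommGroup W] [Module ℂ W] (M : Quasimodule A W)

/-- `M.IsMonomial S p x`: the vector `x` is obtained from an element of `S` by applying modes of
homogeneous vectors whose weights add up to `p`. -/
inductive IsMonomial (S : Set W) : ℤ → W → Prop
  | of (s : W) (hs : s ∈ S) : IsMonomial S 0 s
  | mode {a p : ℤ} {v : V} (hv : v ∈ A.wt a) (m : ℤ) {x : W} (hx : IsMonomial S p x) :
      IsMonomial S (p + a) (M.Y v m x)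

/-- The filtration of `W` by the total weight of the monomials in modes that are applied to the
elements of `S`. -/
def weightFiltration (S : Set W) (p : ℤ) : Submodule ℂ W :=
  Submodule.span ℂ {x | ∃ q ≤ p, M.IsMonomial S q x}

variable {S : Set W}

lemma weightFiltration_mono {p q : ℤ} (h : p ≤ q) :
    M.weightFiltration S p ≤ M.weightFiltration S q :=
  Submodule.span_mono fun _ ⟨r, hr, hx⟩ => ⟨r, hr.trans h, hx⟩

lemma mode_mem_weightFiltration {a p q : ℤ} {v : V} (hv : v ∈ A.wt a) (m : ℤ) {x : W}
    (hx : x ∈ M.weightFiltration S p) (h : p + a ≤ q) :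
    M.Y v m x ∈ M.weightFiltration S q := by
  induction hx using Submodule.span_induction with
  | mem x hx =>
    obtain ⟨r, hr, hx⟩ := hx
    exact Submodule.subset_span ⟨r + a, by omega, .mode hv m hx⟩
  | zero => rw [map_zero]; exact Submodule.zero_mem _
  | add x y _ _ hx hy => rw [map_add]; exact Submodule.add_mem _ hx hy
  | smul c x _ hx => rw [map_smul]; exact Submodule.smul_mem _ c hx

lemma weightFiltration_eq_bot (hA : A.IsNGraded) {p : ℤ} (hp : p < 0) :
    M.weightFiltration S p = ⊥ := by
  have key : ∀ {q : ℤ} {x : W}, M.IsMonomial S q x → 0 ≤ q ∨ x = 0 := by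
    intro q x hx
    induction hx with
    | of s hs => exact .inl le_rfl
    | @mode a p v hv m x hx ih =>
      rcases lt_or_ge a 0 with ha | ha
      · right
        rw [hA a ha, Submodule.mem_bot] at hv
        simp [hv]
      · rcases ih with ih | ih
        · left; omega
        · right; simp [ih]
  rw [weightFiltration, Submodule.span_eq_bot]
  rintro x ⟨q, hq, hx⟩
  exact (key hx).resolve_left (by omega)

lemma exists_mem_weightFiltration (hS : M.IsGeneratedBy S) (w : W) :
    ∃ p, w ∈ M.weightFiltration S p := by
  have hdir : Directed (· ≤ ·) (M.weightFiltration S) := fun p q =>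
    ⟨max p q, M.weightFiltration_mono (le_max_left _ _), M.weightFiltration_mono (le_max_right _ _)⟩
  have htop : ⨆ p, M.weightFiltration S p = ⊤ := by
    refine hS _ (fun s hs => ?_) fun v n x hx => ?_
    · exact Submodule.mem_iSup_of_mem 0 (Submodule.subset_span ⟨0, le_rfl, .of s hs⟩)
    · obtain ⟨p, hp⟩ := (Submodule.mem_iSup_of_directed _ hdir).1 hx
      induction A.mem_span_homogeneous v using Submodule.span_induction with
      | mem v hv =>
        obtain ⟨a, ha⟩ := hv
        exact Submodule.mem_iSup_of_mem (p + a) (M.mode_mem_weightFiltration ha n hp le_rfl)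
      | zero => simp
      | add u v _ _ hu hv => simpa using Submodule.add_mem _ hu hv
      | smul c v _ hv => simpa using Submodule.smul_mem _ c hv
  exact (Submodule.mem_iSup_of_directed _ hdir).1 (htop ▸ Submodule.mem_top)

/-- Modes of homogeneous vectors commute up to terms of lower weight, because the weight of `u_k v`
is less than the sum of the weights for `k ≥ 0`. -/
lemma commutator_mem_weightFiltration {a b p q : ℤ} {u v : V} (hu : u ∈ A.wt a) (hv : v ∈ A.wt b)
    (m n : ℤ) {x : W} (hx : x ∈ M.weightFiltration S p) (h : p + a + b - 1 ≤ q) :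
    M.Y u m (M.Y v n x) - M.Y v n (M.Y u m x) ∈ M.weightFiltration S q := by
  obtain ⟨N, hN⟩ := A.truncation u v
  rw [M.commutator hu hv m n x (K := N.toNat) fun k hk => hN k (by omega)]
  refine Submodule.sum_mem _ fun k _ => Submodule.smul_mem _ _ ?_
  exact M.mode_mem_weightFiltration (A.mode_mem_wt hu hv k) _ hx (by omega)

/-- The modes of `u_l v` lie in the term of the filtration given by the weights of `u` and `v`; for
`l ≤ -2` this is less than the weight of `u_l v`. -/
lemma iterate_mem_weightFiltration {a b p q : ℤ} {u v : V} (hu : u ∈ A.wt a) (hv : v ∈ A.wt b)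
    (l n : ℤ) {x : W} (hx : x ∈ M.weightFiltration S p) (h : p + a + b ≤ q) :
    M.Y (A.Y u l v) n x ∈ M.weightFiltration S q := by
  rw [M.iterate hu hv]
  refine Submodule.sub_mem _ ?_ ?_
  · refine finsum_induction (· ∈ M.weightFiltration S q) (Submodule.zero_mem _)
      (fun _ _ => Submodule.add_mem _) fun k => Submodule.smul_mem _ _ ?_
    exact M.mode_mem_weightFiltration hu _ (M.mode_mem_weightFiltration hv _ hx le_rfl) (by omega)
  · refine finsum_induction (· ∈ M.weightFiltration S q) (Submodule.zero_mem _)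
      (fun _ _ => Submodule.add_mem _) fun k => Submodule.smul_mem _ _ ?_
    exact M.mode_mem_weightFiltration hv _ (M.mode_mem_weightFiltration hu _ hx le_rfl) (by omega)

lemma choose_neg_one (k : ℕ) : Ring.choose (-1 : ℤ) k = (-1) ^ k := by
  induction k with
  | zero => simp
  | succ k ih =>
    have h := Ring.choose_succ_succ (-1 : ℤ) k
    rw [neg_add_cancel, Ring.choose_zero_succ] at h
    rw [pow_succ, ← ih]
    linarith

/-- The normally ordered product formula for `(u_{-1} v)_n`. -/
lemma iterate_neg_one {a b : ℤ} {u v : V} (hu : u ∈ A.wt a) (hv : v ∈ A.wt b) (n : ℤ) (w : W) :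
    M.Y (A.Y u (-1) v) n w =
      (∑ᶠ k : ℕ, M.Y u (-1 - k) (M.Y v (n + k) w)) +
        ∑ᶠ k : ℕ, M.Y v (n - 1 - k) (M.Y u k w) := by
  have h1 : ∀ k : ℕ, ((-1 : ℂ) ^ k * (-1) ^ k) = 1 := fun k => by rw [← mul_pow]; simp
  rw [M.iterate hu hv, sub_eq_add_neg, ← finsum_neg_distrib]
  congr 1
  · refine finsum_congr fun k => ?_
    rw [choose_neg_one]
    push_cast
    rw [h1, one_smul]
  · refine finsum_congr fun k => ?_
    rw [choose_neg_one, zpow_add₀ (by norm_num), zpow_natCast, mul_assoc]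
    push_cast
    rw [h1]
    simp [← sub_eq_add_neg]

/-- High modes of a vector of weight `a` raise the filtration degree by less than `a`: this holds on
`S`, and modes commute up to lower terms. -/
lemma exists_mode_mem_weightFiltration (hS : S.Finite) {a : ℤ} {v : V} (hv : v ∈ A.wt a) :
    ∃ N : ℤ, ∀ m, N ≤ m → ∀ p, ∀ x ∈ M.weightFiltration S p,
      M.Y v m x ∈ M.weightFiltration S (p + a - 1) := by
  choose N hN using fun s => M.truncation v s
  obtain ⟨B, hB⟩ := (hS.image N).bddAbove
  refine ⟨B, fun m hm p x hx => ?_⟩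
  have key : ∀ {q : ℤ} {x : W}, M.IsMonomial S q x → M.Y v m x ∈ M.weightFiltration S (q + a - 1) := by
    intro q x hx
    induction hx with
    | of s hs =>
      rw [hN s m ((hB ⟨s, hs, rfl⟩).trans hm)]
      exact Submodule.zero_mem _
    | @mode b q u hu n x hx ih =>
      rw [← sub_add_cancel (M.Y v m _) (M.Y u n (M.Y v m x))]
      refine Submodule.add_mem _ ?_ (M.mode_mem_weightFiltration hu n ih (by omega))
      exact M.commutator_mem_weightFiltration hv hu m n
        (Submodule.subset_span ⟨q, le_rfl, hx⟩) (by omega)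
  induction hx using Submodule.span_induction with
  | mem x hx =>
    obtain ⟨r, hr, hx⟩ := hx
    exact M.weightFiltration_mono (by omega) (key hx)
  | zero => rw [map_zero]; exact Submodule.zero_mem _
  | add x y _ _ hx hy => rw [map_add]; exact Submodule.add_mem _ hx hy
  | smul c x _ hx => rw [map_smul]; exact Submodule.smul_mem _ c hx

/-- The part of the weight filtration that is of lower weight or visibly in the image of the modes
`v_i` with `i ≤ -n`. -/
def reducible (S : Set W) (n : ℤ) (p : ℤ) : Submodule ℂ W :=
  M.weightFiltration S (p - 1) ⊔ Submodule.span ℂ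
    {y | ∃ a, ∃ v ∈ A.wt a, ∃ i ≤ -n, ∃ x ∈ M.weightFiltration S (p - a), y = M.Y v i x}

lemma weightFiltration_le_reducible {n p q : ℤ} (h : q ≤ p - 1) :
    M.weightFiltration S q ≤ M.reducible S n p :=
  (M.weightFiltration_mono h).trans le_sup_left

lemma mode_mem_reducible {n a p : ℤ} {v : V} (hv : v ∈ A.wt a) (m : ℤ) {x : W}
    (hx : x ∈ M.reducible S n p) : M.Y v m x ∈ M.reducible S n (p + a) := by
  obtain ⟨y, hy, z, hz, rfl⟩ := Submodule.mem_sup.1 hx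
  rw [map_add]
  refine Submodule.add_mem _
    (M.weightFiltration_le_reducible le_rfl (M.mode_mem_weightFiltration hv m hy (by omega))) ?_
  clear hx
  induction hz using Submodule.span_induction with
  | mem z hz =>
    obtain ⟨b, u, hu, i, hi, t, ht, rfl⟩ := hz
    rw [← sub_add_cancel (M.Y v m _) (M.Y u i (M.Y v m t))]
    refine Submodule.add_mem _ (M.weightFiltration_le_reducible le_rfl
      (M.commutator_mem_weightFiltration hv hu m i ht (by omega))) ?_
    exact Submodule.mem_sup_right (Submodule.subset_span ⟨b, u, hu, i, hi, _,
      M.mode_mem_weightFiltration hv m ht (by omega), rfl⟩)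
  | zero => rw [map_zero]; exact Submodule.zero_mem _
  | add x y _ _ hx hy => rw [map_add]; exact Submodule.add_mem _ hx hy
  | smul c x _ hx => rw [map_smul]; exact Submodule.smul_mem _ c hx

end Quasimodule

/-! ### The associated graded space and its fields -/

section GradedQuotient

variable {W : Type*} [AddCommGroup W] [Module ℂ W]

/-- The direct sum of the quotients `G p / (G p ∩ K p)` for two families of subspaces. -/
abbrev GradedQuotient (G K : ℤ → Submodule ℂ W) : Type _ :=
  DirectSum ℤ fun p => G p ⧸ (K p).submoduleOf (G p)

namespace GradedQuotient

variable {G K : ℤ → Submodule ℂ W}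

variable (G K) in
/-- The class of an element of `G p`. -/
def cls (p : ℤ) (x : W) (hx : x ∈ G p) : GradedQuotient G K :=
  DirectSum.lof ℂ ℤ (fun p => G p ⧸ (K p).submoduleOf (G p)) p (Submodule.Quotient.mk ⟨x, hx⟩)

lemma cls_congr {p q : ℤ} (h : p = q) {x y : W} (hx : x ∈ G p) (hy : y ∈ G q)
    (hxy : x - y ∈ K q) : cls G K p x hx = cls G K q y hy := by
  subst h
  exact congrArg (DirectSum.lof ℂ ℤ (fun p => G p ⧸ (K p).submoduleOf (G p)) p)
    ((Submodule.Quotient.eq _).2 hxy)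

lemma cls_eq_zero {p : ℤ} {x : W} (hx : x ∈ G p) (h : x ∈ K p) : cls G K p x hx = 0 := by
  rw [cls, (Submodule.Quotient.mk_eq_zero _).2 (by exact h), map_zero]

lemma cls_add {p : ℤ} {x y : W} (hx : x ∈ G p) (hy : y ∈ G p) :
    cls G K p (x + y) (add_mem hx hy) = cls G K p x hx + cls G K p y hy := by
  rw [cls, cls, cls, ← map_add]
  rfl

lemma cls_smul {p : ℤ} {x : W} (c : ℂ) (hx : x ∈ G p) :
    cls G K p (c • x) (Submodule.smul_mem _ c hx) = c • cls G K p x hx := by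
  rw [cls, cls, ← map_smul]
  rfl

lemma cls_sum {ι : Type*} (s : Finset ι) {p : ℤ} {x : ι → W} (hx : ∀ i, x i ∈ G p) :
    cls G K p (∑ i ∈ s, x i) (Submodule.sum_mem _ fun i _ => hx i) =
      ∑ i ∈ s, cls G K p (x i) (hx i) := by
  classical
  induction s using Finset.induction_on with
  | empty => simpa using cls_eq_zero (K := K) (zero_mem (G p)) (zero_mem _)
  | insert i s hi ih =>
    rw [Finset.sum_insert hi (f := fun i => cls G K p (x i) (hx i)), ← ih, ← cls_add (hx i)]
    exact cls_congr rfl _ _ (by rw [Finset.sum_insert hi, sub_self]; exact zero_mem _)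

lemma hom_ext {Z : Type*} [AddCommMonoid Z] [Module ℂ Z] {f g : GradedQuotient G K →ₗ[ℂ] Z}
    (h : ∀ p x hx, f (cls G K p x hx) = g (cls G K p x hx)) : f = g := by
  refine DirectSum.linearMap_ext ℂ fun p => LinearMap.ext fun y => ?_
  obtain ⟨x, rfl⟩ := Submodule.Quotient.mk_surjective _ y
  exact h p x x.2

/-- The operator of degree `k` induced by an operator that is compatible with the two families. -/
def map (k : ℤ) (T : Module.End ℂ W) (hG : ∀ p, ∀ x ∈ G p, T x ∈ G (p + k))
    (hK : ∀ p, ∀ x ∈ K p, T x ∈ K (p + k)) : Module.End ℂ (GradedQuotient G K) :=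
  DirectSum.toModule ℂ ℤ _ fun p =>
    DirectSum.lof ℂ ℤ (fun p => G p ⧸ (K p).submoduleOf (G p)) (p + k) ∘ₗ
      Submodule.mapQ _ _ (T.restrict (hG p)) fun x hx => hK p x hx

lemma map_cls {k : ℤ} {T : Module.End ℂ W} {hG : ∀ p, ∀ x ∈ G p, T x ∈ G (p + k)}
    {hK : ∀ p, ∀ x ∈ K p, T x ∈ K (p + k)} (p : ℤ) (x : W) (hx : x ∈ G p) :
    map k T hG hK (cls G K p x hx) = cls G K (p + k) (T x) (hG p x hx) := by
  rw [map, cls, DirectSum.toModule_lof]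
  rfl

end GradedQuotient

end GradedQuotient

namespace MobiusVertexAlgebra

variable {V : Type*} [AddCommGroup V] [Module ℂ V] (A : MobiusVertexAlgebra V)

/-- The decomposition of a vector into its homogeneous components. -/
def weightDecomposition : V ≃ₗ[ℂ] DirectSum ℤ fun a => A.wt a :=
  (LinearEquiv.ofBijective (DirectSum.coeLinearMap A.wt) A.isInternal).symm

lemma weightDecomposition_of_mem {a : ℤ} {v : V} (hv : v ∈ A.wt a) :
    A.weightDecomposition v = DirectSum.lof ℂ ℤ (fun a => A.wt a) a ⟨v, hv⟩ :=
  (LinearEquiv.symm_apply_eq _).2 (DirectSum.coeLinearMap_lof A.wt a ⟨v, hv⟩).symm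

end MobiusVertexAlgebra

/-- A finitely supported sum over the integers, split into its nonnegative and negative parts. -/
lemma finsum_int_eq {Z : Type*} [AddCommMonoid Z] (f : ℤ → Z) (L : ℕ)
    (h : ∀ i : ℤ, i < -L ∨ L ≤ i → f i = 0) :
    ∑ᶠ i, f i = ∑ k ∈ Finset.range L, f (-1 - k) + ∑ k ∈ Finset.range L, f k := by
  classical
  rw [finsum_eq_sum_of_support_subset (s := (Finset.range L).image (fun k : ℕ => -1 - (k : ℤ)) ∪
    (Finset.range L).image (fun k : ℕ => (k : ℤ))), Finset.sum_union, Finset.sum_image,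
    Finset.sum_image]
  · exact fun a _ b _ hab => by simpa using hab
  · exact fun a _ b _ hab => by simpa using hab
  · rw [Finset.disjoint_left]
    intro i hi hi'
    simp only [Finset.mem_image] at hi hi'
    omega
  · intro i hi
    have h1 : -(L : ℤ) ≤ i ∧ i < L := by
      by_contra hc
      exact hi (h i (by omega))
    simp only [Finset.coe_union, Finset.coe_image, Set.mem_union, Set.mem_image, Finset.coe_range,
      Set.mem_Iio]
    rcases lt_or_ge i 0 with h0 | h0
    · exact .inl ⟨(-1 - i).toNat, by omega, by omega⟩
    · exact .inr ⟨i.toNat, by omega, by omega⟩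

namespace Quasimodule

open GradedQuotient

variable {V : Type*} [AddCommGroup V] [Module ℂ V] {A : MobiusVertexAlgebra V}
  {W : Type*} [AddCommGroup W] [Module ℂ W] (M : Quasimodule A W)

/-- The graded space associated with the weight filtration, modulo the images of the modes
`v_i` with `i ≤ -n`. -/
abbrev reducedGraded (S : Set W) (n : ℤ) : Type _ :=
  GradedQuotient (M.weightFiltration S) (M.reducible S n)

lemma reducedGraded_hom_ext {S : Set W} {n : ℤ} {f g : Module.End ℂ (M.reducedGraded S n)}
    (h : ∀ p x hx, f (cls (M.weightFiltration S) (M.reducible S n) p x hx) =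
      g (cls (M.weightFiltration S) (M.reducible S n) p x hx)) : f = g :=
  hom_ext (G := M.weightFiltration S) (K := M.reducible S n) h

/-- The action of the modes of vectors of weight `a` on the associated graded space. -/
def gradedModeOfWeight (S : Set W) (n a : ℤ) :
    A.wt a →ₗ[ℂ] (ℤ → Module.End ℂ (M.reducedGraded S n)) where
  toFun v m := GradedQuotient.map a (M.Y v m)
    (fun _ _ hx => M.mode_mem_weightFiltration v.2 m hx le_rfl)
    (fun _ _ hx => M.mode_mem_reducible v.2 m hx)
  map_add' u v := by
    funext m
    refine M.reducedGraded_hom_ext fun p x hx => ?_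
    rw [Pi.add_apply, LinearMap.add_apply, map_cls, map_cls, map_cls, ← cls_add]
    exact cls_congr rfl _ _ (by simp)
  map_smul' c v := by
    funext m
    refine M.reducedGraded_hom_ext fun p x hx => ?_
    rw [RingHom.id_apply, Pi.smul_apply, LinearMap.smul_apply, map_cls, map_cls, ← cls_smul]
    exact cls_congr rfl _ _ (by simp)

/-- The action of all modes on the associated graded space, by linearity from the homogeneous
vectors. -/
def gradedMode (S : Set W) (n : ℤ) : V →ₗ[ℂ] (ℤ → Module.End ℂ (M.reducedGraded S n)) :=
  DirectSum.toModule ℂ ℤ _ (M.gradedModeOfWeight S n) ∘ₗ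
    A.weightDecomposition.toLinearMap

variable {S : Set W} {n : ℤ}

lemma gradedMode_cls {a : ℤ} {v : V} (hv : v ∈ A.wt a) (m p : ℤ) (x : W)
    (hx : x ∈ M.weightFiltration S p) :
    M.gradedMode S n v m (cls _ _ p x hx) =
      cls _ _ (p + a) (M.Y v m x) (M.mode_mem_weightFiltration hv m hx le_rfl) := by
  rw [gradedMode, LinearMap.comp_apply, LinearEquiv.coe_coe, A.weightDecomposition_of_mem hv,
    DirectSum.toModule_lof]
  exact map_cls (hK := fun _ _ hx => M.mode_mem_reducible hv m hx) p x hx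

lemma gradedMode_comm {a b : ℤ} {u v : V} (hu : u ∈ A.wt a) (hv : v ∈ A.wt b) (m k : ℤ) :
    M.gradedMode S n u m * M.gradedMode S n v k = M.gradedMode S n v k * M.gradedMode S n u m := by
  refine M.reducedGraded_hom_ext fun p x hx => ?_
  rw [Module.End.mul_apply, Module.End.mul_apply, M.gradedMode_cls hv, M.gradedMode_cls hu,
    M.gradedMode_cls hu, M.gradedMode_cls hv]
  refine cls_congr (by ring) _ _ (M.weightFiltration_le_reducible le_rfl ?_)
  exact M.commutator_mem_weightFiltration hu hv m k hx (by omega)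

lemma gradedMode_eq_zero_of_le {a : ℤ} {v : V} (hv : v ∈ A.wt a) {m : ℤ} (hm : m ≤ -n) :
    M.gradedMode S n v m = 0 := by
  refine M.reducedGraded_hom_ext fun p x hx => ?_
  rw [M.gradedMode_cls hv, LinearMap.zero_apply]
  exact cls_eq_zero _ (Submodule.mem_sup_right (Submodule.subset_span
    ⟨a, v, hv, m, hm, x, by simpa using hx, rfl⟩))

lemma exists_gradedMode_eq_zero (hS : S.Finite) {a : ℤ} {v : V} (hv : v ∈ A.wt a) :
    ∃ N : ℤ, ∀ m, N ≤ m → M.gradedMode S n v m = 0 := by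
  obtain ⟨N, hN⟩ := M.exists_mode_mem_weightFiltration hS hv
  refine ⟨N, fun m hm => M.reducedGraded_hom_ext fun p x hx => ?_⟩
  rw [M.gradedMode_cls hv, LinearMap.zero_apply]
  exact cls_eq_zero _ (M.weightFiltration_le_reducible le_rfl (hN m hm p x hx))

lemma support_gradedMode_finite (hS : S.Finite) {a : ℤ} {v : V} (hv : v ∈ A.wt a) :
    (Function.support (M.gradedMode S n v)).Finite := by
  obtain ⟨N, hN⟩ := M.exists_gradedMode_eq_zero (n := n) hS hv
  refine (Set.finite_Ioo (-n) N).subset fun m hm => ⟨?_, ?_⟩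
  · by_contra h
    exact hm (M.gradedMode_eq_zero_of_le hv (not_lt.1 h))
  · by_contra h
    exact hm (hN m (not_lt.1 h))

lemma gradedMode_vac (m : ℤ) : M.gradedMode S n A.vac m = if m = -1 then 1 else 0 := by
  refine M.reducedGraded_hom_ext fun p x hx => ?_
  rw [M.gradedMode_cls A.vac_mem]
  split_ifs with h
  · exact cls_congr (add_zero p) _ _ (by simp [M.vacuum, h])
  · exact cls_eq_zero _ (by simp [M.vacuum, h])

/-- `C₂(V)` acts trivially on the associated graded space, because `u_{-2} v` has a weight that is
larger than the sum of the weights of `u` and `v`. -/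
lemma gradedMode_eq_zero_of_mem_C {v : V} (hv : v ∈ A.Y.C 2) : M.gradedMode S n v = 0 := by
  have key : A.Y.C 2 ≤ LinearMap.ker (M.gradedMode S n) := by
    refine Submodule.span_le.2 ?_
    rintro _ ⟨u, v, rfl⟩
    rw [SetLike.mem_coe, LinearMap.mem_ker]
    induction A.mem_span_homogeneous u using Submodule.span_induction with
    | mem u hu =>
      obtain ⟨a, ha⟩ := hu
      induction A.mem_span_homogeneous v using Submodule.span_induction with
      | mem v hv =>
        obtain ⟨b, hb⟩ := hv
        funext m
        refine M.reducedGraded_hom_ext fun p x hx => ?_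
        rw [M.gradedMode_cls (A.mode_mem_wt ha hb _)]
        exact cls_eq_zero _ (M.weightFiltration_le_reducible le_rfl
          (M.iterate_mem_weightFiltration ha hb _ m hx (by push_cast; omega)))
      | zero => simp
      | add v w _ _ hv hw => rw [map_add, map_add, hv, hw, add_zero]
      | smul c v _ hv => rw [map_smul, map_smul, hv, smul_zero]
    | zero => simp
    | add v w _ _ hv hw => rw [map_add, Pi.add_apply, LinearMap.add_apply, map_add, hv, hw, add_zero]
    | smul c v _ hv => rw [map_smul, Pi.smul_apply, LinearMap.smul_apply, map_smul, hv, smul_zero]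
  exact key hv

/-- On the associated graded space the field of `u_{-1} v` is the product of the fields of `u` and
`v`. -/
lemma gradedMode_neg_one (hS : S.Finite) {a b : ℤ} {u v : V} (hu : u ∈ A.wt a) (hv : v ∈ A.wt b)
    (m : ℤ) : M.gradedMode S n (A.Y u (-1) v) m =
      ∑ᶠ i : ℤ, M.gradedMode S n u i * M.gradedMode S n v (m - 1 - i) := by
  obtain ⟨Nu, hNu⟩ := M.exists_gradedMode_eq_zero (n := n) hS hu
  obtain ⟨Nv, hNv⟩ := M.exists_gradedMode_eq_zero (n := n) hS hv
  refine M.reducedGraded_hom_ext fun p x hx => ?_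
  obtain ⟨Nu', hNu'⟩ := M.truncation u x
  obtain ⟨Nv', hNv'⟩ := M.truncation v x
  -- all sums are cut off at a common bound
  obtain ⟨L, hL⟩ : ∃ L : ℕ, Nu ≤ L ∧ Nv ≤ m + L ∧ Nu' ≤ L ∧ Nv' ≤ m + L :=
    ⟨(max (max Nu (Nv - m)) (max Nu' (Nv' - m))).toNat, by omega⟩
  rw [finsum_int_eq _ L, LinearMap.add_apply, LinearMap.sum_apply, LinearMap.sum_apply,
    M.gradedMode_cls (A.mode_mem_wt hu hv _)]
  swap
  · rintro i (hi | hi)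
    · rw [hNv _ (by omega), mul_zero]
    · rw [hNu _ (by omega), zero_mul]
  simp only [Module.End.mul_apply, M.gradedMode_cls hv, M.gradedMode_cls hu]
  rw [← cls_sum (p := p + b + a) (x := fun k : ℕ => M.Y u (-1 - k) (M.Y v (m - 1 - (-1 - k)) x)),
    ← cls_sum (p := p + b + a) (x := fun k : ℕ => M.Y u k (M.Y v (m - 1 - k) x)), ← cls_add]
  refine cls_congr (by ring) _ _ (M.weightFiltration_le_reducible le_rfl ?_)
  rw [M.iterate_neg_one hu hv, finsum_eq_sum_of_support_subset (s := Finset.range L),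
    finsum_eq_sum_of_support_subset (s := Finset.range L), add_sub_add_comm,
    ← Finset.sum_sub_distrib, ← Finset.sum_sub_distrib]
  · refine Submodule.add_mem _ (Submodule.sum_mem _ fun k _ => ?_)
      (Submodule.sum_mem _ fun k _ => ?_)
    · rw [show m - 1 - (-1 - (k : ℤ)) = m + k by ring, sub_self]
      exact Submodule.zero_mem _
    · exact M.commutator_mem_weightFiltration hv hu _ _ hx (by omega)
  · intro k hk
    by_contra hc
    simp only [Finset.coe_range, Set.mem_Iio, not_lt] at hc
    exact hk (by simp [hNu' k (by omega)])
  · intro k hk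
    by_contra hc
    simp only [Finset.coe_range, Set.mem_Iio, not_lt] at hc
    exact hk (by simp [hNv' (m + k) (by omega)])

/-- The associated graded space is generated by the classes of the elements of `S`. -/
lemma reducedGraded_generated (N : Submodule ℂ (M.reducedGraded S n))
    (hSN : ∀ s ∈ S, ∀ hs, cls (M.weightFiltration S) (M.reducible S n) 0 s hs ∈ N)
    (hN : ∀ v ∈ A.homogeneous, ∀ m, ∀ x ∈ N, M.gradedMode S n v m x ∈ N) : N = ⊤ := by
  have key : ∀ {q : ℤ} {x : W} (_ : M.IsMonomial S q x) (h : x ∈ M.weightFiltration S q),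
      cls (M.weightFiltration S) (M.reducible S n) q x h ∈ N := by
    intro q x hx
    induction hx with
    | of s hs => exact fun h => hSN s hs h
    | @mode a q v hv m x hx ih =>
      intro h
      have hxq : x ∈ M.weightFiltration S q := Submodule.subset_span ⟨q, le_rfl, hx⟩
      rw [← M.gradedMode_cls hv m q x hxq]
      exact hN v ⟨a, hv⟩ m _ (ih hxq)
  have hcls : ∀ p x, x ∈ M.weightFiltration S p → ∀ h : x ∈ M.weightFiltration S p,
      cls (M.weightFiltration S) (M.reducible S n) p x h ∈ N := by
    intro p x hx
    induction hx using Submodule.span_induction with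
    | mem x hx =>
      intro h
      obtain ⟨q, hq, hx⟩ := hx
      rcases hq.eq_or_lt with rfl | hlt
      · exact key hx h
      · rw [cls_eq_zero h (M.weightFiltration_le_reducible (q := q) (by omega)
          (Submodule.subset_span ⟨q, le_rfl, hx⟩))]
        exact Submodule.zero_mem _
    | zero =>
      intro h
      rw [cls_eq_zero h (Submodule.zero_mem _)]
      exact Submodule.zero_mem _
    | add x y hx hy ihx ihy =>
      intro h
      have hx : x ∈ M.weightFiltration S p := hx
      have hy : y ∈ M.weightFiltration S p := hy
      rw [cls_add hx hy]
      exact Submodule.add_mem _ (ihx hx) (ihy hy)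
    | smul c x hx ih =>
      intro h
      have hx : x ∈ M.weightFiltration S p := hx
      rw [cls_smul c hx]
      exact Submodule.smul_mem _ c (ih hx)
  refine eq_top_iff.2 fun y _ => ?_
  induction y using DirectSum.induction_on with
  | zero => exact Submodule.zero_mem _
  | of p y =>
    obtain ⟨x, rfl⟩ := Submodule.Quotient.mk_surjective _ y
    exact hcls p x x.2 x.2
  | add x y hx hy => exact Submodule.add_mem _ (hx trivial) (hy trivial)

/-- The associated graded space is finite-dimensional. -/
lemma finiteDimensional_reducedGraded (hC2 : A.IsCofinite 2) (hS : S.Finite) :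
    FiniteDimensional ℂ (M.reducedGraded S n) := by
  have : FiniteDimensional ℂ (V ⧸ A.Y.C 2) := hC2
  have hmem : ∀ s ∈ S, s ∈ M.weightFiltration S 0 := fun s hs =>
    Submodule.subset_span ⟨0, le_rfl, .of s hs⟩
  have : Finite S := hS
  refine finiteDimensional_of_commuting_fields (M.gradedMode S n) A.homogeneous
    A.span_homogeneous ?_ ?_ ⟨A.vac, M.gradedMode_vac⟩ ?_ (A.Y.C 2)
    (fun v hv => M.gradedMode_eq_zero_of_mem_C hv)
    (Set.range fun s : S => cls (M.weightFiltration S) (M.reducible S n) 0 s (hmem s s.2))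
    (Set.finite_range _) ?_
  · rintro u ⟨a, hu⟩ v ⟨b, hv⟩ m k
    exact M.gradedMode_comm hu hv m k
  · rintro v ⟨a, hv⟩
    exact M.support_gradedMode_finite hS hv
  · rintro u ⟨a, hu⟩ v ⟨b, hv⟩
    exact ⟨_, M.gradedMode_neg_one hS hu hv⟩
  · intro N hSN hN
    exact M.reducedGraded_generated N (fun s hs _ => hSN ⟨⟨s, hs⟩, rfl⟩) hN

end Quasimodule

/-! ### Cofiniteness -/

namespace GradedQuotient

variable {W : Type*} [AddCommGroup W] [Module ℂ W] {G K : ℤ → Submodule ℂ W}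

/-- Lifts of the elements of a finite-dimensional graded quotient span a finite-dimensional space. -/
lemma exists_finiteDimensional_lift [FiniteDimensional ℂ (GradedQuotient G K)] :
    ∃ F : Submodule ℂ W, FiniteDimensional ℂ F ∧ ∀ p, ∀ x ∈ G p, ∃ y ∈ F, x - y ∈ K p := by
  choose σ hσ using fun p => ((K p).submoduleOf (G p)).mkQ.exists_rightInverse_of_surjective
    (Submodule.range_mkQ _)
  let Φ : GradedQuotient G K →ₗ[ℂ] W :=
    DirectSum.toModule ℂ ℤ W fun p => (G p).subtype ∘ₗ σ p
  refine ⟨LinearMap.range Φ, inferInstance, fun p x hx => ⟨_, ⟨cls G K p x hx, rfl⟩, ?_⟩⟩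
  rw [cls, DirectSum.toModule_lof]
  have h := LinearMap.congr_fun (hσ p) (Submodule.Quotient.mk ⟨x, hx⟩)
  exact (Submodule.Quotient.eq ((K p).submoduleOf (G p))).1 h.symm

end GradedQuotient

namespace Quasimodule

variable {V : Type*} [AddCommGroup V] [Module ℂ V] {A : MobiusVertexAlgebra V}
  {W : Type*} [AddCommGroup W] [Module ℂ W] (M : Quasimodule A W)

lemma mode_mem_C {n : ℕ} (hn : 1 ≤ n) {i : ℤ} (hi : i ≤ -n) (v : V) (w : W) :
    M.Y v i w ∈ M.Y.C n := by
  obtain ⟨k, rfl⟩ : ∃ k : ℕ, i = -n - k := ⟨(-n - i).toNat, by omega⟩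
  clear hi
  induction k generalizing v with
  | zero => exact Submodule.subset_span ⟨v, w, by simp⟩
  | succ k ih =>
    -- `v_{j-1}` is a nonzero multiple of `(L(-1)v)_j` for `j ≠ 0`
    have h := ih (A.L 0 v)
    rw [M.covariant.deriv, LinearMap.smul_apply] at h
    have hne : -((-n - k : ℤ) : ℂ) ≠ 0 := neg_ne_zero.2 (Int.cast_ne_zero.2 (by omega))
    have h' := (Submodule.smul_mem_iff _ hne).1 h
    rwa [show (-n - k : ℤ) - 1 = -n - (k + 1 : ℕ) by push_cast; ring] at h'

lemma C_two_le_c1 (hA : A.IsNGraded) : M.Y.C 2 ≤ M.c1 := by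
  refine Submodule.span_le.2 ?_
  rintro _ ⟨v, w, rfl⟩
  rw [SetLike.mem_coe]
  induction A.mem_span_homogeneous v using Submodule.span_induction with
  | mem v hv =>
    obtain ⟨a, hv⟩ := hv
    rcases lt_or_ge a 0 with ha | ha
    · rw [hA a ha, Submodule.mem_bot] at hv
      simp [hv]
    · refine Submodule.subset_span ⟨A.L 0 v, ?_, w, ?_⟩
      · exact Submodule.mem_iSup_of_mem (a + 1)
          (Submodule.mem_iSup_of_mem (by omega) (A.translation_mem_wt hv))
      · rw [M.covariant.deriv]
        norm_num
  | zero => simp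
  | add u v _ _ hu hv => simpa using Submodule.add_mem _ hu hv
  | smul c v _ hv => simpa using Submodule.smul_mem _ c hv

theorem isCofinite_of_isGeneratedBy (hA : A.IsNGraded) (hC2 : A.IsCofinite 2) {S : Set W}
    (hS : S.Finite) (hgen : M.IsGeneratedBy S) {n : ℕ} (hn : 1 ≤ n) : M.IsCofinite n := by
  have := M.finiteDimensional_reducedGraded (n := n) hC2 hS
  obtain ⟨F, hF, hFG⟩ := GradedQuotient.exists_finiteDimensional_lift
    (G := M.weightFiltration S) (K := M.reducible S n)
  have hred : ∀ p, M.reducible S n p ≤ M.weightFiltration S (p - 1) ⊔ M.Y.C n := by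
    refine fun p => sup_le_sup_left (Submodule.span_le.2 ?_) _
    rintro _ ⟨a, v, -, i, hi, x, -, rfl⟩
    exact M.mode_mem_C hn hi v x
  have key : ∀ k : ℕ, M.weightFiltration S (k - 1) ≤ F ⊔ M.Y.C n := by
    intro k
    induction k with
    | zero =>
      rw [M.weightFiltration_eq_bot hA (by norm_num)]
      exact bot_le
    | succ k ih =>
      intro x hx
      obtain ⟨y, hy, hxy⟩ := hFG _ x hx
      rw [← sub_add_cancel x y]
      refine Submodule.add_mem _ ?_ (Submodule.mem_sup_left hy)
      have h := hred _ hxy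
      rw [show ((k + 1 : ℕ) : ℤ) - 1 - 1 = k - 1 by push_cast; ring] at h
      exact (sup_le ih le_sup_right) h
  have htop : F ⊔ M.Y.C n = ⊤ := by
    refine eq_top_iff.2 fun w _ => ?_
    obtain ⟨p, hp⟩ := M.exists_mem_weightFiltration hgen w
    exact key (p + 1).toNat (M.weightFiltration_mono (by omega) hp)
  refine Module.Finite.of_surjective ((M.Y.C n).mkQ ∘ₗ F.subtype) ?_
  rw [← LinearMap.range_eq_top, LinearMap.range_comp, Submodule.range_subtype,
    Submodule.map_mkQ_eq_top, sup_comm, htop]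

theorem isC1Cofinite_of_isGeneratedBy (hA : A.IsNGraded) (hC2 : A.IsCofinite 2) {S : Set W}
    (hS : S.Finite) (hgen : M.IsGeneratedBy S) : M.IsC1Cofinite := by
  have : FiniteDimensional ℂ (W ⧸ M.Y.C 2) :=
    M.isCofinite_of_isGeneratedBy hA hC2 hS hgen one_le_two
  exact Module.Finite.of_surjective (Submodule.factor (M.C_two_le_c1 hA))
    (Submodule.factor_surjective _)

end Quasimodule

end

theorem mainTheorem3 {V : Type*} [AddCommGroup V] [Module ℂ V] (A : MobiusVertexAlgebra V)
    (hA : A.IsNGraded) (hC2 : A.IsCofinite 2)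
    {W : Type*} [AddCommGroup W] [Module ℂ W] (M : Quasimodule A W) :
    (∀ w : W, M.IsGeneratedBy {w} → (∀ n : ℕ, 2 ≤ n → M.IsCofinite n) ∧ M.IsC1Cofinite) ∧
    (∀ S : Set W, S.Finite → M.IsGeneratedBy S →
      (∀ n : ℕ, 2 ≤ n → M.IsCofinite n) ∧ M.IsC1Cofinite) := by
  have h : ∀ S : Set W, S.Finite → M.IsGeneratedBy S →
      (∀ n : ℕ, 2 ≤ n → M.IsCofinite n) ∧ M.IsC1Cofinite := fun S hS hgen =>
    ⟨fun n hn => M.isCofinite_of_isGeneratedBy hA hC2 hS hgen (by omega),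
      M.isC1Cofinite_of_isGeneratedBy hA hC2 hS hgen⟩
  exact ⟨fun w => h {w} (Set.finite_singleton w), h⟩
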